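/- Let $\mathcal M$ be a smooth supermanifold of dimension $(N|N)$ with algebra of smooth functions $\mathcal F_{\mathcal M}$; write $\varepsilon(\cdot)$ for the parity of a homogeneous function or vector field. Let $(\cdot,\cdot)$ be a nondegenerate antibracket on $\mathcal M$, that is, a bilinear operation with $\varepsilon((F,G))=\varepsilon(F)+\varepsilon(G)+1$, $(F,G)=-(-1)^{(\varepsilon(F)+1)(\varepsilon(G)+1)}(G,F)$, $(F,GH)=(F,G)H+(-1)^{\varepsilon(G)(\varepsilon(F)+1)}G(F,H)$ and $(-1)^{(\varepsilon(F)+1)(\varepsilon(H)+1)}(F,(G,H))+\text{cycle}(F,G,H)=0$, whose matrix $(\Gamma^A,\Gamma^B)$ in local coordinates $\Gamma^A$ is invertible. Let $\mathbf Q$ be an odd vector field with $\mathbf Q^2=0$ and $\mathbf Q(F,G)=(\mathbf QF,G)+(-1)^{\varepsilon(F)+1}(F,\mathbf QG)$. Assume that $(\mathcal M,(\cdot,\cdot),\mathbf Q)$ is a P-QP-manifold: the zero locus $\mathcal Z_{\mathbf Q}$ of $\mathbf Q$, defined by the equations $Q^A=0$ for $\mathbf Q=Q^A\partial_A$, is a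 submanifold whose ideal $\mathcal I\subset\mathcal F_{\mathcal M}$ is generated by the functions $\mathbf QF$, and the local cohomology of $\mathbf Q$ (the cohomology on germs of functions) at every point of $\mathcal Z_{\mathbf Q}$ consists of the constants only. Put $\mathcal F_{\mathcal Z_{\mathbf Q}}=\mathcal F_{\mathcal M}/\mathcal I$, with the Poisson bracket induced by $\{F,G\}=(F,\mathbf QG)$, and likewise over open subsets. Let $\mathbf X$ be a homogeneous vector field on $\mathcal M$ that preserves the antibracket, $$\mathbf X(F,G)-(\mathbf XF,G)-(-1)^{(\varepsilon(F)+1)\varepsilon(\mathbf X)}(F,\mathbf XG)=0\qquad\text{for all }F,G,$$ and whose graded commutator with $\mathbf Q$ vanishes, $[\mathbf Q,\mathbf X]=0$. Then: 1. $\mathbf X$ restricts to $\mathcal Z_{\mathbf Q}$: there is a unique vector field $\mathbf x=\mathbf X|_{\mathcal Z_{\mathbf Q}}$ on $\mathcal Z_{\mathbf Q}$, of the same parity, with $\mathbf x(F|_{\mathcal Z_{\mathbf Q}})=(\mathbf XF)|_{\mathcal Z_{\mathbf Q}}$ for all functions $F$. 2. $\mathbf x$ preserves the Poisson bracket: $$\mathbf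 x\{f,g\}-\{\mathbf xf,g\}-(-1)^{\varepsilon(f)\varepsilon(\mathbf X)}\{f,\mathbf xg\}=0\qquad\text{for all functions }f,g\text{ on }\mathcal Z_{\mathbf Q}.$$ 3. $\mathbf x$ is locally Hamiltonian: every point of $\mathcal Z_{\mathbf Q}$ has a neighbourhood in $\mathcal Z_{\mathbf Q}$ on which $\mathbf x=\{H,\cdot\,\}$ for some function $H$. -/

import Mathlib

open scoped Manifold ContDiff
open TopologicalSpace (Opens)

universe u v

noncomputable section

namespace Super

/-! ### Presheaves of supercommutative algebras -/

/-- A presheaf of supercommutative (`ℤ/2`-graded commutative) real algebras on `M`. -/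
structure SuperPresheaf (M : Type u) [TopologicalSpace M] where
  /-- the algebra of sections (functions) over an open set -/
  Sec : Opens M → Type v
  [ring : ∀ U, Ring (Sec U)]
  [algebra : ∀ U, Algebra ℝ (Sec U)]
  /-- the subspace of sections of a given parity -/
  part : ∀ U, ZMod 2 → Submodule ℝ (Sec U)
  isCompl : ∀ U, IsCompl (part U 0) (part U 1)
  one_mem : ∀ U, (1 : Sec U) ∈ part U 0
  mul_mem : ∀ {U i j} {F G : Sec U}, F ∈ part U i → G ∈ part U j → F * G ∈ part U (i + j)
  supercomm : ∀ {U i j} {F G : Sec U}, F ∈ part U i → G ∈ part U j →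
    F * G = ((-1 : ℤˣ) ^ (i * j)) • (G * F)
  /-- restriction of sections to a smaller open set -/
  res : ∀ {U V : Opens M}, U ≤ V → Sec V →ₐ[ℝ] Sec U
  res_self : ∀ {U} (F : Sec U), res le_rfl F = F
  res_res : ∀ {U V W : Opens M} (h : U ≤ V) (k : V ≤ W) (F : Sec W),
    res h (res k F) = res (h.trans k) F
  res_mem : ∀ {U V : Opens M} (h : U ≤ V) {i} {F : Sec V}, F ∈ part V i → res h F ∈ part U i

attribute [instance] SuperPresheaf.ring SuperPresheaf.algebra

variable {M : Type u} [TopologicalSpace M]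

/-- The sheaf axioms: sections that agree locally are equal, and compatible families glue. -/
structure SuperPresheaf.IsSheaf (O : SuperPresheaf.{u, v} M) : Prop where
  locality : ∀ (U : Opens M) (F G : O.Sec U),
    (∀ x ∈ U, ∃ (V : Opens M) (h : V ≤ U), x ∈ V ∧ O.res h F = O.res h G) → F = G
  gluing : ∀ (ι : Type u) (V : ι → Opens M) (s : ∀ i, O.Sec (V i)),
    (∀ i j, O.res (inf_le_left : V i ⊓ V j ≤ V i) (s i) =
      O.res (inf_le_right : V i ⊓ V j ≤ V j) (s j)) →
    ∃ F : O.Sec (⨆ i, V i), ∀ i, O.res (le_iSup V i) F = s i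

/-! ### Supermanifolds -/

/-- The Grassmann algebra on `q` generators. -/
abbrev Grassmann (q : ℕ) : Type := ExteriorAlgebra ℝ (Fin q → ℝ)

/-- The even (`i = 0`) and odd (`i = 1`) elements of the Grassmann algebra. -/
def Grassmann.part (q : ℕ) (i : ZMod 2) : Submodule ℝ (Grassmann q) :=
  CliffordAlgebra.evenOdd (0 : QuadraticForm ℝ (Fin q → ℝ)) i

section Model

variable {p : ℕ} [ChartedSpace (EuclideanSpace ℝ (Fin p)) M]

variable (p) in
/-- The algebra `C^∞(U) ⊗ Λ(ℝ^q)` of smooth Grassmann-algebra-valued functions on an open subset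
`U` of a smooth manifold, with pointwise operations. Smoothness is that of all components. -/
def smoothGrassmann (q : ℕ) (U : Opens M) : Subalgebra ℝ (U → Grassmann q) where
  carrier := {f | ∀ l : Grassmann q →ₗ[ℝ] ℝ,
    ContMDiff 𝓘(ℝ, EuclideanSpace ℝ (Fin p)) 𝓘(ℝ, ℝ) ∞ (fun x => l (f x))}
  add_mem' := by
    intro f g hf hg l
    have h := (hf l).add (hg l)
    refine h.congr fun x => ?_
    simp
  algebraMap_mem' := by
    intro r l
    exact contMDiff_const (c := l (algebraMap ℝ (Grassmann q) r))
  mul_mem' := by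
    intro f g hf hg l
    have key : ∀ x : U, l ((f * g) x) =
        ∑ s, ∑ t, ((Pi.basisFun ℝ (Fin q)).ExteriorAlgebra.coord s (f x) *
          (Pi.basisFun ℝ (Fin q)).ExteriorAlgebra.coord t (g x)) *
          l ((Pi.basisFun ℝ (Fin q)).ExteriorAlgebra s *
            (Pi.basisFun ℝ (Fin q)).ExteriorAlgebra t) := by
      intro x
      conv_lhs =>
        rw [Pi.mul_apply, ← (Pi.basisFun ℝ (Fin q)).ExteriorAlgebra.sum_repr (f x),
          ← (Pi.basisFun ℝ (Fin q)).ExteriorAlgebra.sum_repr (g x), Finset.sum_mul_sum]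
      simp only [map_sum, smul_mul_smul_comm, map_smul, smul_eq_mul, Module.Basis.coord_apply]
    simp only [key]
    refine contMDiff_finsetSum fun s _ => contMDiff_finsetSum fun t _ => ?_
    exact ((hf _).mul (hg _)).mul contMDiff_const

/-- A local coordinate system (superchart) of dimension `p|q` on `M` with structure presheaf `O`:
on the open set `dom` an isomorphism of `O` with the sheaf `C^∞ ⊗ Λ(ℝ^q)`, and a smooth chart of
the underlying manifold, defined on `dom`. -/
structure SuperChart (p q : ℕ) [ChartedSpace (EuclideanSpace ℝ (Fin p)) M]
    (O : SuperPresheaf.{u, v} M) where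
  dom : Opens M
  chart : OpenPartialHomeomorph M (EuclideanSpace ℝ (Fin p))
  chart_mem : chart ∈ IsManifold.maximalAtlas 𝓘(ℝ, EuclideanSpace ℝ (Fin p)) ∞ M
  dom_subset : (dom : Set M) ⊆ chart.source
  triv : ∀ U : Opens M, U ≤ dom → (O.Sec U ≃ₐ[ℝ] smoothGrassmann p q U)
  triv_mem : ∀ (U : Opens M) (h : U ≤ dom) (i : ZMod 2) (F : O.Sec U),
    F ∈ O.part U i ↔ ∀ x : U, (triv U h F).1 x ∈ Grassmann.part q i
  triv_res : ∀ (U V : Opens M) (h : U ≤ V) (k : V ≤ dom) (F : O.Sec V) (x : U),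
    (triv U (h.trans k) (O.res h F)).1 x = (triv V k F).1 ⟨x, h x.2⟩

/-- The coordinate functions of a superchart: the `p` even coordinates are the components of the
chart of the underlying manifold, the `q` odd coordinates are the generators of `Λ(ℝ^q)`. -/
def SuperChart.coord {q : ℕ} {O : SuperPresheaf.{u, v} M} (c : SuperChart p q O) :
    Fin p ⊕ Fin q → O.Sec c.dom
  | Sum.inl i => (c.triv c.dom le_rfl).symm
      ⟨fun x => algebraMap ℝ (Grassmann q) (c.chart x i), by
        intro l
        have h1 : ContMDiff 𝓘(ℝ, EuclideanSpace ℝ (Fin p)) 𝓘(ℝ, EuclideanSpace ℝ (Fin p)) ∞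
            (fun x : c.dom => c.chart x) := fun x =>
          (((contMDiffOn_of_mem_maximalAtlas c.chart_mem).contMDiffAt
            (c.chart.open_source.mem_nhds (c.dom_subset x.2))).comp x
            (contMDiff_subtype_val (U := c.dom) x))
        have h2 : ContDiff ℝ ∞ (fun y : EuclideanSpace ℝ (Fin p) =>
            l (algebraMap ℝ (Grassmann q) (y i))) := by
          have : ∀ y : EuclideanSpace ℝ (Fin p),
              l (algebraMap ℝ (Grassmann q) (y i)) = y i * l 1 := by
            intro y
            rw [Algebra.algebraMap_eq_smul_one, map_smul, smul_eq_mul]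
          simp only [this]
          fun_prop
        exact h2.contMDiff.comp h1⟩
  | Sum.inr j => (c.triv c.dom le_rfl).symm
      ⟨fun _ => ExteriorAlgebra.ι ℝ (Pi.single j 1), fun _ => contMDiff_const⟩

/-- `(M, O)` is a smooth supermanifold of dimension `p|q`: `O` is a sheaf of supercommutative
algebras on the smooth manifold `M` that is locally isomorphic to `C^∞ ⊗ Λ(ℝ^q)`. -/
structure IsSupermanifold (p q : ℕ) [ChartedSpace (EuclideanSpace ℝ (Fin p)) M]
    (O : SuperPresheaf.{u, v} M) : Prop where
  isSheaf : O.IsSheaf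
  exists_chart : ∀ x : M, ∃ c : SuperChart p q O, x ∈ c.dom

end Model

/-! ### Vector fields and antibrackets -/

/-- A (homogeneous) vector field of parity `ε`: a graded derivation of the sheaf of functions. -/
@[ext]
structure VectorField (O : SuperPresheaf.{u, v} M) (ε : ZMod 2) where
  app : ∀ U, O.Sec U →ₗ[ℝ] O.Sec U
  app_mem : ∀ {U i} {F : O.Sec U}, F ∈ O.part U i → app U F ∈ O.part U (i + ε)
  leibniz : ∀ {U i} {F : O.Sec U}, F ∈ O.part U i → ∀ G : O.Sec U,
    app U (F * G) = app U F * G + ((-1 : ℤˣ) ^ (ε * i)) • (F * app U G)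
  app_res : ∀ {U V : Opens M} (h : U ≤ V) (F : O.Sec V),
    app U (O.res h F) = O.res h (app V F)

/-- An antibracket. -/
structure Antibracket (O : SuperPresheaf.{u, v} M) where
  br : ∀ U, O.Sec U →ₗ[ℝ] O.Sec U →ₗ[ℝ] O.Sec U
  br_mem : ∀ {U i j} {F G : O.Sec U}, F ∈ O.part U i → G ∈ O.part U j →
    br U F G ∈ O.part U (i + j + 1)
  antisymm : ∀ {U i j} {F G : O.Sec U}, F ∈ O.part U i → G ∈ O.part U j →
    br U F G = -(((-1 : ℤˣ) ^ ((i + 1) * (j + 1))) • br U G F)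
  leibniz : ∀ {U i j} {F G : O.Sec U}, F ∈ O.part U i → G ∈ O.part U j → ∀ H : O.Sec U,
    br U F (G * H) = br U F G * H + ((-1 : ℤˣ) ^ (j * (i + 1))) • (G * br U F H)
  jacobi : ∀ {U i j k} {F G H : O.Sec U},
    F ∈ O.part U i → G ∈ O.part U j → H ∈ O.part U k →
    ((-1 : ℤˣ) ^ ((i + 1) * (k + 1))) • br U F (br U G H) +
    ((-1 : ℤˣ) ^ ((j + 1) * (i + 1))) • br U G (br U H F) +
    ((-1 : ℤˣ) ^ ((k + 1) * (j + 1))) • br U H (br U F G) = 0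
  br_res : ∀ {U V : Opens M} (h : U ≤ V) (F G : O.Sec V),
    br U (O.res h F) (O.res h G) = O.res h (br V F G)

/-- The antibracket is nondegenerate: in local coordinates `Γ^A` the matrix of functions
`(Γ^A, Γ^B)` is invertible. -/
def Antibracket.Nondegenerate (N : ℕ) [ChartedSpace (EuclideanSpace ℝ (Fin N)) M]
    {O : SuperPresheaf.{u, v} M} (B : Antibracket O) : Prop :=
  ∀ c : SuperChart N N O,
    IsUnit (Matrix.of fun a b => B.br c.dom (c.coord a) (c.coord b))

/-- The vector field `X` preserves the antibracket. -/
def Antibracket.PreservedBy {O : SuperPresheaf.{u, v} M} (B : Antibracket O) {ε : ZMod 2}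
    (X : VectorField O ε) : Prop :=
  ∀ (U : Opens M) (i : ZMod 2) (F G : O.Sec U), F ∈ O.part U i →
    X.app U (B.br U F G) - B.br U (X.app U F) G
      - ((-1 : ℤˣ) ^ ((i + 1) * ε)) • B.br U F (X.app U G) = 0

/-- The graded commutator of two vector fields vanishes. -/
def Supercommute {O : SuperPresheaf.{u, v} M} {ε δ : ZMod 2}
    (X : VectorField O ε) (Y : VectorField O δ) : Prop :=
  ∀ (U : Opens M) (F : O.Sec U),
    X.app U (Y.app U F) - ((-1 : ℤˣ) ^ (ε * δ)) • Y.app U (X.app U F) = 0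

/-- A QP-structure on `(M, O)`: a nondegenerate antibracket and an odd nilpotent vector field
`Q` which preserves it. -/
structure QPStructure (N : ℕ) [ChartedSpace (EuclideanSpace ℝ (Fin N)) M]
    (O : SuperPresheaf.{u, v} M) where
  bracket : Antibracket O
  nondegenerate : bracket.Nondegenerate N
  Q : VectorField O 1
  Q_preserves : bracket.PreservedBy Q
  Q_sq : ∀ (U : Opens M) (F : O.Sec U), Q.app U (Q.app U F) = 0

/-! ### The zero locus of an odd vector field -/

namespace VectorField

variable {O : SuperPresheaf.{u, v} M} (Q : VectorField O 1)

/-- The ideal generated by the functions of the form `Q F`; in local coordinates it is generated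
by the components `Q^A = Q Γ^A`. -/
def exactIdeal (U : Opens M) : Ideal (O.Sec U) := Ideal.span (Set.range (Q.app U))

lemma res_mem_exactIdeal {U V : Opens M} (h : U ≤ V) {F : O.Sec V} (hF : F ∈ Q.exactIdeal V) :
    O.res h F ∈ Q.exactIdeal U := by
  have : Q.exactIdeal V ≤ (Q.exactIdeal U).comap (O.res h) := by
    refine Ideal.span_le.2 ?_
    rintro _ ⟨G, rfl⟩
    refine Ideal.subset_span ⟨O.res h G, ?_⟩
    exact Q.app_res h G
  exact this hF

/-- The ideal of functions (over `U`) vanishing on the zero locus of `Q`: the ideal sheaf generated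
by the components of `Q`, i.e. the functions that are locally of the form `∑ G_k * Q F_k`. -/
def zeroIdeal (U : Opens M) : Ideal (O.Sec U) where
  carrier := {F | ∀ x ∈ U, ∃ (V : Opens M) (h : V ≤ U), x ∈ V ∧ O.res h F ∈ Q.exactIdeal V}
  zero_mem' := fun x hx => ⟨U, le_rfl, hx, by rw [map_zero]; exact Ideal.zero_mem _⟩
  add_mem' := by
    intro F G hF hG x hx
    obtain ⟨V, h, hxV, hV⟩ := hF x hx
    obtain ⟨W, k, hxW, hW⟩ := hG x hx
    refine ⟨V ⊓ W, inf_le_left.trans h, ⟨hxV, hxW⟩, ?_⟩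
    have h1 := Q.res_mem_exactIdeal (inf_le_left : V ⊓ W ≤ V) hV
    have h2 := Q.res_mem_exactIdeal (inf_le_right : V ⊓ W ≤ W) hW
    rw [O.res_res] at h1 h2
    rw [map_add]
    exact Ideal.add_mem _ h1 h2
  smul_mem' := by
    intro G F hF x hx
    obtain ⟨V, h, hxV, hV⟩ := hF x hx
    refine ⟨V, h, hxV, ?_⟩
    rw [smul_eq_mul, map_mul]
    exact Ideal.mul_mem_left _ _ hV

/-- The zero set of `Q`: the points at which all components of `Q` vanish. (A function vanishes at
`x` if and only if its germ at `x` is not invertible.) -/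
def zeroSet : Set M :=
  {x | ∀ U : Opens M, x ∈ U → ∀ F : O.Sec U, ¬ IsUnit (Q.app U F)}

end VectorField

/-! ### The zero locus as a superspace -/

namespace SuperPresheaf

variable (O : SuperPresheaf.{u, v} M)

/-- Every section is the sum of its even and odd parts. -/
lemma exists_parts {U : Opens M} (F : O.Sec U) :
    ∃ F₀ ∈ O.part U 0, ∃ F₁ ∈ O.part U 1, F₀ + F₁ = F := by
  have h : F ∈ O.part U 0 ⊔ O.part U 1 := by
    rw [(O.isCompl U).sup_eq_top]; trivial
  exact Submodule.mem_sup.1 h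

lemma parts_unique {U : Opens M} {F₀ F₁ G₀ G₁ : O.Sec U} (hF₀ : F₀ ∈ O.part U 0)
    (hF₁ : F₁ ∈ O.part U 1) (hG₀ : G₀ ∈ O.part U 0) (hG₁ : G₁ ∈ O.part U 1)
    (h : F₀ + F₁ = G₀ + G₁) : F₀ = G₀ ∧ F₁ = G₁ := by
  have e : F₀ - G₀ = G₁ - F₁ := by
    rw [sub_eq_sub_iff_add_eq_add, h, add_comm]
  have h0 : F₀ - G₀ = 0 := by
    have := Submodule.disjoint_def.1 (O.isCompl U).disjoint (F₀ - G₀)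
      (Submodule.sub_mem _ hF₀ hG₀) (e ▸ Submodule.sub_mem _ hG₁ hF₁)
    exact this
  have h1 : G₁ - F₁ = 0 := e ▸ h0
  exact ⟨sub_eq_zero.1 h0, (sub_eq_zero.1 h1).symm⟩

lemma units_smul_mem {U : Opens M} (I : Ideal (O.Sec U)) (s : ℤˣ) {F : O.Sec U} (hF : F ∈ I) :
    s • F ∈ I := by
  rcases Int.units_eq_one_or s with rfl | rfl
  · simpa using hF
  · simpa using hF

end SuperPresheaf

namespace VectorField

variable {O : SuperPresheaf.{u, v} M} (Q : VectorField O 1)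

lemma exactIdeal_parts {U : Opens M} {F : O.Sec U} (hF : F ∈ Q.exactIdeal U) :
    ∃ F₀ ∈ O.part U 0, ∃ F₁ ∈ O.part U 1,
      F₀ ∈ Q.exactIdeal U ∧ F₁ ∈ Q.exactIdeal U ∧ F₀ + F₁ = F := by
  refine Submodule.span_induction (p := fun F _ => ∃ F₀ ∈ O.part U 0, ∃ F₁ ∈ O.part U 1,
      F₀ ∈ Q.exactIdeal U ∧ F₁ ∈ Q.exactIdeal U ∧ F₀ + F₁ = F) ?_ ?_ ?_ ?_ hF
  · rintro _ ⟨G, rfl⟩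
    obtain ⟨G₀, h₀, G₁, h₁, rfl⟩ := O.exists_parts G
    refine ⟨Q.app U G₁, ?_, Q.app U G₀, ?_, Ideal.subset_span ⟨_, rfl⟩,
      Ideal.subset_span ⟨_, rfl⟩, ?_⟩
    · simpa [CharTwo.add_self_eq_zero] using Q.app_mem h₁
    · simpa using Q.app_mem h₀
    · rw [map_add, add_comm]
  · exact ⟨0, Submodule.zero_mem _, 0, Submodule.zero_mem _, Ideal.zero_mem _, Ideal.zero_mem _,
      add_zero 0⟩
  · rintro _ _ _ _ ⟨F₀, h₀, F₁, h₁, i₀, i₁, rfl⟩ ⟨G₀, k₀, G₁, k₁, j₀, j₁, rfl⟩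
    exact ⟨F₀ + G₀, Submodule.add_mem _ h₀ k₀, F₁ + G₁, Submodule.add_mem _ h₁ k₁,
      Ideal.add_mem _ i₀ j₀, Ideal.add_mem _ i₁ j₁, by abel⟩
  · rintro A _ _ ⟨F₀, h₀, F₁, h₁, i₀, i₁, rfl⟩
    obtain ⟨A₀, k₀, A₁, k₁, rfl⟩ := O.exists_parts A
    refine ⟨A₀ * F₀ + A₁ * F₁, ?_, A₀ * F₁ + A₁ * F₀, ?_, ?_, ?_, ?_⟩
    · exact Submodule.add_mem _ (by simpa using O.mul_mem k₀ h₀)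
        (by simpa [CharTwo.add_self_eq_zero] using O.mul_mem k₁ h₁)
    · exact Submodule.add_mem _ (by simpa using O.mul_mem k₀ h₁) (by simpa using O.mul_mem k₁ h₀)
    · exact Ideal.add_mem _ (Ideal.mul_mem_left _ _ i₀) (Ideal.mul_mem_left _ _ i₁)
    · exact Ideal.add_mem _ (Ideal.mul_mem_left _ _ i₁) (Ideal.mul_mem_left _ _ i₀)
    · rw [smul_eq_mul]; noncomm_ring

lemma zeroIdeal_parts {U : Opens M} {F₀ F₁ : O.Sec U} (h₀ : F₀ ∈ O.part U 0)
    (h₁ : F₁ ∈ O.part U 1) (hF : F₀ + F₁ ∈ Q.zeroIdeal U) :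
    F₀ ∈ Q.zeroIdeal U ∧ F₁ ∈ Q.zeroIdeal U := by
  have key : ∀ x ∈ U, ∃ (V : Opens M) (h : V ≤ U), x ∈ V ∧
      O.res h F₀ ∈ Q.exactIdeal V ∧ O.res h F₁ ∈ Q.exactIdeal V := by
    intro x hx
    obtain ⟨V, h, hxV, hV⟩ := hF x hx
    obtain ⟨G₀, k₀, G₁, k₁, j₀, j₁, e⟩ := Q.exactIdeal_parts hV
    rw [map_add] at e
    obtain ⟨e₀, e₁⟩ := O.parts_unique k₀ k₁ (O.res_mem h h₀) (O.res_mem h h₁) e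
    exact ⟨V, h, hxV, e₀ ▸ j₀, e₁ ▸ j₁⟩
  constructor
  · intro x hx
    obtain ⟨V, h, hxV, hV, -⟩ := key x hx
    exact ⟨V, h, hxV, hV⟩
  · intro x hx
    obtain ⟨V, h, hxV, -, hV⟩ := key x hx
    exact ⟨V, h, hxV, hV⟩

lemma exactIdeal_le_zeroIdeal (U : Opens M) : Q.exactIdeal U ≤ Q.zeroIdeal U :=
  fun F hF x hx => ⟨U, le_rfl, hx, by rwa [O.res_self]⟩

lemma app_mem_zeroIdeal {U : Opens M} (F : O.Sec U) : Q.app U F ∈ Q.zeroIdeal U :=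
  Q.exactIdeal_le_zeroIdeal U (Ideal.subset_span ⟨F, rfl⟩)

lemma res_mem_zeroIdeal {U V : Opens M} (h : U ≤ V) {F : O.Sec V} (hF : F ∈ Q.zeroIdeal V) :
    O.res h F ∈ Q.zeroIdeal U := by
  intro x hx
  obtain ⟨W, k, hxW, hW⟩ := hF x (h hx)
  refine ⟨U ⊓ W, inf_le_left, ⟨hx, hxW⟩, ?_⟩
  have := Q.res_mem_exactIdeal (inf_le_right : U ⊓ W ≤ W) hW
  rw [O.res_res] at this ⊢
  exact this

instance zeroIdeal_isTwoSided (U : Opens M) : (Q.zeroIdeal U).IsTwoSided where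
  mul_mem_of_left := by
    intro F G hF
    obtain ⟨F₀, h₀, F₁, h₁, rfl⟩ := O.exists_parts F
    obtain ⟨G₀, k₀, G₁, k₁, rfl⟩ := O.exists_parts G
    obtain ⟨i₀, i₁⟩ := Q.zeroIdeal_parts h₀ h₁ hF
    have e : (F₀ + F₁) * (G₀ + G₁) = F₀ * G₀ + F₀ * G₁ + (F₁ * G₀ + F₁ * G₁) := by noncomm_ring
    rw [e, O.supercomm h₀ k₀, O.supercomm h₀ k₁, O.supercomm h₁ k₀, O.supercomm h₁ k₁]
    exact Ideal.add_mem _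
      (Ideal.add_mem _ (O.units_smul_mem _ _ (Ideal.mul_mem_left _ _ i₀))
        (O.units_smul_mem _ _ (Ideal.mul_mem_left _ _ i₀)))
      (Ideal.add_mem _ (O.units_smul_mem _ _ (Ideal.mul_mem_left _ _ i₁))
        (O.units_smul_mem _ _ (Ideal.mul_mem_left _ _ i₁)))

/-- The zero locus `Z_Q` of `Q` as a superspace, with the functions `C^∞(Z_Q) = C^∞(M) / I`. Its
sections over `U` are the functions on the open part `Z_Q ∩ U` of `Z_Q`, that is, the functions on
`U` modulo those vanishing on `Z_Q`. -/
def zeroLocus : SuperPresheaf.{u, v} M where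
  Sec U := O.Sec U ⧸ Q.zeroIdeal U
  ring U := Ideal.Quotient.ring (Q.zeroIdeal U)
  algebra U := Ideal.Quotient.algebra ℝ
  part U i := (O.part U i).map (Ideal.Quotient.mkₐ ℝ (Q.zeroIdeal U)).toLinearMap
  isCompl U := by
    constructor
    · rw [Submodule.disjoint_def]
      rintro _ ⟨F, hF, rfl⟩ ⟨G, hG, e⟩
      have e' : F - G ∈ Q.zeroIdeal U := Ideal.Quotient.eq.1 e.symm
      rw [sub_eq_add_neg] at e'
      have := (Q.zeroIdeal_parts hF (Submodule.neg_mem _ hG) e').1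
      exact Ideal.Quotient.eq_zero_iff_mem.2 this
    · rw [codisjoint_iff, ← Submodule.map_sup, (O.isCompl U).sup_eq_top, Submodule.map_top,
        LinearMap.range_eq_top]
      exact Ideal.Quotient.mkₐ_surjective ℝ _
  one_mem U := ⟨1, O.one_mem U, rfl⟩
  mul_mem := by
    rintro U i j _ _ ⟨F, hF, rfl⟩ ⟨G, hG, rfl⟩
    exact ⟨F * G, O.mul_mem hF hG, rfl⟩
  supercomm := by
    rintro U i j _ _ ⟨F, hF, rfl⟩ ⟨G, hG, rfl⟩
    have := congrArg (Ideal.Quotient.mk (Q.zeroIdeal U)) (O.supercomm hF hG)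
    rcases Int.units_eq_one_or ((-1 : ℤˣ) ^ (i * j)) with h | h <;> rw [h] at this ⊢ <;>
      simpa using this
  res h := Ideal.quotientMapₐ _ (O.res h) (fun _ hF => Q.res_mem_zeroIdeal h hF)
  res_self := by
    rintro U ⟨F⟩
    exact congrArg (Ideal.Quotient.mk (Q.zeroIdeal U)) (O.res_self F)
  res_res := by
    rintro U V W h k ⟨F⟩
    exact congrArg (Ideal.Quotient.mk (Q.zeroIdeal U)) (O.res_res h k F)
  res_mem := by
    rintro U V h i _ ⟨F, hF, rfl⟩
    exact ⟨O.res h F, O.res_mem h hF, rfl⟩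

/-- The restriction of functions from `M` to the zero locus. -/
def toZeroLocus (U : Opens M) : O.Sec U →ₐ[ℝ] Q.zeroLocus.Sec U :=
  Ideal.Quotient.mkₐ ℝ (Q.zeroIdeal U)

/-- The vector field `x` on the zero locus is the restriction of the vector field `X` on `M`:
`x (F|_Z) = (X F)|_Z` for all functions `F`. -/
def IsRestriction {ε : ZMod 2} (X : VectorField O ε) (x : VectorField Q.zeroLocus ε) : Prop :=
  ∀ (U : Opens M) (F : O.Sec U),
    x.app U (Q.toZeroLocus U F) = Q.toZeroLocus U (X.app U F)

/-- The zero locus is a submanifold whose ideal is generated by the functions `Q F`: near each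
of its points there are coordinates such that the ideal is generated by some of them. -/
def ZeroLocusIsSubmanifold (p q : ℕ) [ChartedSpace (EuclideanSpace ℝ (Fin p)) M] : Prop :=
  ∀ z ∈ Q.zeroSet, ∃ c : SuperChart p q O, z ∈ c.dom ∧ ∃ A : Set (Fin p ⊕ Fin q),
    ∀ (U : Opens M) (h : U ≤ c.dom),
      Q.zeroIdeal U = Ideal.span ((fun a => O.res h (c.coord a)) '' A)

/-- The local cohomology of `Q` at `z` is trivial: the cohomology of `Q` on germs of functions at
`z` consists of the constants. -/
def LocalCohomologyTrivialAt (z : M) : Prop :=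
  ∀ (U : Opens M), z ∈ U → ∀ F : O.Sec U, Q.app U F = 0 →
    ∃ (V : Opens M) (h : V ≤ U), z ∈ V ∧
      ∃ (r : ℝ) (G : O.Sec V), O.res h F = algebraMap ℝ (O.Sec V) r + Q.app V G

end VectorField

/-! ### QP-manifolds: the Poisson bracket on the zero locus, and symmetries -/

namespace QPStructure

variable {N : ℕ} [ChartedSpace (EuclideanSpace ℝ (Fin N)) M] {O : SuperPresheaf.{u, v} M}
  (S : QPStructure N O)

/-- A P-QP-manifold: the zero locus of `Q` is a submanifold whose ideal is generated by the
`Q`-exact functions, and the local cohomology of `Q` is trivial at each of its points. -/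
structure IsPQP : Prop where
  isSubmanifold : S.Q.ZeroLocusIsSubmanifold N N
  cohomology : ∀ z ∈ S.Q.zeroSet, S.Q.LocalCohomologyTrivialAt z

/-- A symmetry: the vector field `X` preserves the antibracket and commutes with `Q`. -/
structure IsSymmetry {ε : ZMod 2} (X : VectorField O ε) : Prop where
  preserves : S.bracket.PreservedBy X
  commutes : Supercommute S.Q X

lemma br_Q_Q {U : Opens M} (F G : O.Sec U) :
    S.bracket.br U (S.Q.app U F) (S.Q.app U G) =
      S.Q.app U (S.bracket.br U F (S.Q.app U G)) := by
  have h : ∀ i, ∀ F ∈ O.part U i, S.bracket.br U (S.Q.app U F) (S.Q.app U G) =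
      S.Q.app U (S.bracket.br U F (S.Q.app U G)) := by
    intro i F hF
    have := S.Q_preserves U i F (S.Q.app U G) hF
    rw [S.Q_sq, map_zero, smul_zero, sub_zero] at this
    exact (sub_eq_zero.1 this).symm
  obtain ⟨F₀, h₀, F₁, h₁, rfl⟩ := O.exists_parts F
  simp only [map_add, LinearMap.add_apply, h 0 F₀ h₀, h 1 F₁ h₁]

lemma br_mem_of_exact {U : Opens M} {F : O.Sec U} (hF : F ∈ S.Q.exactIdeal U) (G : O.Sec U) :
    S.bracket.br U F (S.Q.app U G) ∈ S.Q.zeroIdeal U := by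
  have hom : ∀ i j k (A B G : O.Sec U), A ∈ O.part U i → B ∈ O.part U j → G ∈ O.part U k →
      S.bracket.br U (A * S.Q.app U B) (S.Q.app U G) ∈ S.Q.zeroIdeal U := by
    intro i j k A B G hA hB hG
    have hQB := S.Q.app_mem hB
    have hQG := S.Q.app_mem hG
    rw [S.bracket.antisymm (O.mul_mem hA hQB) hQG, S.bracket.leibniz hQG hA, S.br_Q_Q]
    refine Ideal.neg_mem_iff _ |>.2 (O.units_smul_mem _ _ (Ideal.add_mem _ ?_
      (O.units_smul_mem _ _ ?_)))
    · exact Ideal.mul_mem_left _ _ (S.Q.app_mem_zeroIdeal B)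
    · exact Ideal.mul_mem_left _ _ (S.Q.app_mem_zeroIdeal _)
  have gen : ∀ A B : O.Sec U,
      S.bracket.br U (A * S.Q.app U B) (S.Q.app U G) ∈ S.Q.zeroIdeal U := by
    intro A B
    obtain ⟨A₀, a₀, A₁, a₁, rfl⟩ := O.exists_parts A
    obtain ⟨B₀, b₀, B₁, b₁, rfl⟩ := O.exists_parts B
    obtain ⟨G₀, g₀, G₁, g₁, rfl⟩ := O.exists_parts G
    simp only [map_add, add_mul, mul_add, LinearMap.add_apply]
    refine Ideal.add_mem _ (Ideal.add_mem _ (Ideal.add_mem _ ?_ ?_) (Ideal.add_mem _ ?_ ?_))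
      (Ideal.add_mem _ (Ideal.add_mem _ ?_ ?_) (Ideal.add_mem _ ?_ ?_)) <;>
    first
      | exact hom _ _ _ _ _ _ a₀ b₀ g₀
      | exact hom _ _ _ _ _ _ a₀ b₀ g₁
      | exact hom _ _ _ _ _ _ a₀ b₁ g₀
      | exact hom _ _ _ _ _ _ a₀ b₁ g₁
      | exact hom _ _ _ _ _ _ a₁ b₀ g₀
      | exact hom _ _ _ _ _ _ a₁ b₀ g₁
      | exact hom _ _ _ _ _ _ a₁ b₁ g₀
      | exact hom _ _ _ _ _ _ a₁ b₁ g₁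
  have all : ∀ A : O.Sec U, S.bracket.br U (A * F) (S.Q.app U G) ∈ S.Q.zeroIdeal U := by
    refine Submodule.span_induction (p := fun F _ => ∀ A : O.Sec U,
      S.bracket.br U (A * F) (S.Q.app U G) ∈ S.Q.zeroIdeal U) ?_ ?_ ?_ ?_ hF
    · rintro _ ⟨B, rfl⟩ A
      exact gen A B
    · intro A
      simp
    · intro F F' _ _ h h' A
      rw [mul_add, map_add, LinearMap.add_apply]
      exact Ideal.add_mem _ (h A) (h' A)
    · intro C F _ h A
      rw [smul_eq_mul, ← mul_assoc]
      exact h (A * C)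
  simpa using all 1

lemma br_mem_left {U : Opens M} {F : O.Sec U} (hF : F ∈ S.Q.zeroIdeal U) (G : O.Sec U) :
    S.bracket.br U F (S.Q.app U G) ∈ S.Q.zeroIdeal U := by
  intro x hx
  obtain ⟨V, h, hxV, hV⟩ := hF x hx
  have := S.br_mem_of_exact hV (O.res h G)
  rw [S.Q.app_res, S.bracket.br_res] at this
  obtain ⟨W, k, hxW, hW⟩ := this x hxV
  exact ⟨W, k.trans h, hxW, by rwa [O.res_res] at hW⟩

lemma br_mem_right {U : Opens M} (F : O.Sec U) {G : O.Sec U} (hG : G ∈ S.Q.zeroIdeal U) :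
    S.bracket.br U F (S.Q.app U G) ∈ S.Q.zeroIdeal U := by
  have hom : ∀ i, ∀ F ∈ O.part U i,
      S.bracket.br U F (S.Q.app U G) ∈ S.Q.zeroIdeal U := by
    intro i F hF
    have h1 : S.bracket.br U (S.Q.app U F) G ∈ S.Q.zeroIdeal U := by
      have hQF := S.Q.app_mem hF
      obtain ⟨G₀, g₀, G₁, g₁, rfl⟩ := O.exists_parts G
      obtain ⟨i₀, i₁⟩ := S.Q.zeroIdeal_parts g₀ g₁ hG
      rw [map_add, S.bracket.antisymm hQF g₀, S.bracket.antisymm hQF g₁]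
      exact Ideal.add_mem _
        (Ideal.neg_mem_iff _ |>.2 (O.units_smul_mem _ _ (S.br_mem_left i₀ F)))
        (Ideal.neg_mem_iff _ |>.2 (O.units_smul_mem _ _ (S.br_mem_left i₁ F)))
    have h2 : ((-1 : ℤˣ) ^ ((i + 1) * 1)) • S.bracket.br U F (S.Q.app U G) ∈
        S.Q.zeroIdeal U := by
      rw [← sub_eq_zero.1 (S.Q_preserves U i F G hF)]
      exact Ideal.sub_mem _ (S.Q.app_mem_zeroIdeal _) h1
    have h3 := O.units_smul_mem _ (((-1 : ℤˣ) ^ ((i + 1) * 1))⁻¹) h2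
    rwa [inv_smul_smul] at h3
  obtain ⟨F₀, h₀, F₁, h₁, rfl⟩ := O.exists_parts F
  rw [map_add, LinearMap.add_apply]
  exact Ideal.add_mem _ (hom 0 F₀ h₀) (hom 1 F₁ h₁)

/-- The Poisson bracket on the zero locus, `{F|_Z, G|_Z} = (F, Q G)|_Z`. -/
def poisson (U : Opens M) (f g : S.Q.zeroLocus.Sec U) : S.Q.zeroLocus.Sec U :=
  Quotient.liftOn₂' f g
    (fun F G => S.Q.toZeroLocus U (S.bracket.br U F (S.Q.app U G))) (by
      intro F G F' G' hF hG
      rw [Submodule.quotientRel_def] at hF hG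
      refine Ideal.Quotient.eq.2 ?_
      have e : S.bracket.br U F (S.Q.app U G) - S.bracket.br U F' (S.Q.app U G') =
          S.bracket.br U (F - F') (S.Q.app U G) + S.bracket.br U F' (S.Q.app U (G - G')) := by
        simp only [map_sub, LinearMap.sub_apply]
        abel
      rw [e]
      exact Ideal.add_mem _ (S.br_mem_left hF G) (S.br_mem_right F' hG))

lemma poisson_toZeroLocus (U : Opens M) (F G : O.Sec U) :
    S.poisson U (S.Q.toZeroLocus U F) (S.Q.toZeroLocus U G) =
      S.Q.toZeroLocus U (S.bracket.br U F (S.Q.app U G)) := rfl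

/-- The vector field `x` on the zero locus preserves the Poisson bracket. -/
def PoissonPreservedBy {ε : ZMod 2} (x : VectorField S.Q.zeroLocus ε) : Prop :=
  ∀ (U : Opens M) (i : ZMod 2) (f g : S.Q.zeroLocus.Sec U), f ∈ S.Q.zeroLocus.part U i →
    x.app U (S.poisson U f g) - S.poisson U (x.app U f) g
      - ((-1 : ℤˣ) ^ (i * ε)) • S.poisson U f (x.app U g) = 0

/-- The vector field `x` on the zero locus is locally Hamiltonian: near each point of the zero
locus it is `{H, ·}` for some function `H`. -/
def IsLocallyHamiltonian {ε : ZMod 2} (x : VectorField S.Q.zeroLocus ε) : Prop :=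
  ∀ z ∈ S.Q.zeroSet, ∃ U : Opens M, z ∈ U ∧ ∃ H : S.Q.zeroLocus.Sec U,
    ∀ (V : Opens M) (h : V ≤ U) (g : S.Q.zeroLocus.Sec V),
      x.app V g = S.poisson V (S.Q.zeroLocus.res h H) g

end QPStructure

end Super

end

/-!
Restriction to the zero locus and preservation of the Poisson bracket are formal: since `X`
commutes with `Q` up to sign it maps the ideal generated by the functions `Q F` to itself
(`QPStructure.IsSymmetry.app_mem_zeroIdeal`), and the Poisson bracket is `(F, Q G)` modulo this
ideal (`QPStructure.IsSymmetry.poissonPreservedBy`).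

That the restriction is locally Hamiltonian rests on the Poincaré lemma. By Hadamard's lemma a
derivation is determined by its values on the coordinates `Γ^a` of a superchart
(`SuperChart.derivation_eq_sum`). As the matrix of the antibracket is invertible, `X` is a
combination `∑ w_a (Γ^a, ·)`, and preservation of the antibracket together with the Jacobi
identity says that the `w_a` form, up to signs, a closed `1`-form
(`SuperChart.pderiv_component_comm`). Over a convex open set such a form is exact
(`SuperChart.exists_primitive`): the odd coordinates are integrated one at a time algebraically,
which leaves an ordinary closed `1`-form on an open subset of `ℝ^N`. Hence `X = (H, ·)` near every
point (`SuperChart.exists_hamiltonian`).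

Now let `z` be a zero of `Q`. The vector field `[Q, X] = 0` is, up to sign, `(Q H, ·)`, so that `Q
H` is a constant, and this constant is `0` because `Q H` vanishes at `z`. As the local cohomology
of `Q` at `z` is trivial, `H = r + Q G` near `z` with `r` a constant. The Hamiltonian vector field
`(Q G, ·)` restricts to `{±G, ·}` on the zero locus (`QPStructure.toZeroLocus_br_Q`), the sign
being that of the parity of `G`.
-/

namespace Super

/-! ### Smooth functions on Euclidean space -/

open MeasureTheory in
/-- Smoothness of an integral in a parameter, by differentiation under the integral sign. -/
theorem contDiff_nat_integral_of_contDiff {E : Type} [NormedAddCommGroup E] [NormedSpace ℝ E]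
    [FiniteDimensional ℝ E] (n : ℕ) :
    ∀ {G : Type} [NormedAddCommGroup G] [NormedSpace ℝ G] [CompleteSpace G] (F : E → ℝ → G),
      ContDiff ℝ n (Function.uncurry F) → ContDiff ℝ n fun x => ∫ t in (0 : ℝ)..1, F x t := by
  induction n with
  | zero =>
    intro G _ _ _ F hF
    rw [CharP.cast_eq_zero, contDiff_zero] at hF ⊢
    exact intervalIntegral.continuous_parametric_intervalIntegral_of_continuous' hF 0 1
  | succ n ih =>
    intro G _ _ _ F hF
    have hF1 : ContDiff ℝ 1 (Function.uncurry F) := hF.of_le (by exact_mod_cast Nat.le_add_left 1 n)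
    -- the derivative in the first variable
    let F' : E → ℝ → E →L[ℝ] G := fun x t =>
      (fderiv ℝ (Function.uncurry F) (x, t)).comp (ContinuousLinearMap.inl ℝ E ℝ)
    have hF' : ContDiff ℝ n (Function.uncurry F') := by
      have h : ContDiff ℝ n (fderiv ℝ (Function.uncurry F)) :=
        hF.fderiv_right (m := n) (by norm_cast)
      exact h.clm_comp contDiff_const
    have hder : ∀ x t, HasFDerivAt (fun x => F x t) (F' x t) x := by
      intro x t
      have h1 : HasFDerivAt (Function.uncurry F) (fderiv ℝ (Function.uncurry F) (x, t)) (x, t) :=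
        (hF1.differentiable (by norm_num) _).hasFDerivAt
      exact HasFDerivAt.comp (f := fun x => (x, t)) x h1 (hasFDerivAt_prodMk_left x t)
    have hcont : Continuous (Function.uncurry F') := hF'.continuous
    have hint : ∀ x, HasFDerivAt (fun x => ∫ t in (0 : ℝ)..1, F x t)
        (∫ t in (0 : ℝ)..1, F' x t) x := by
      intro x₀
      obtain ⟨C, hC⟩ := ((isCompact_closedBall x₀ 1).prod (isCompact_Icc (a := (0 : ℝ)) (b := 1))
        ).exists_bound_of_continuousOn hcont.continuousOn
      refine intervalIntegral.hasFDerivAt_integral_of_dominated_of_fderiv_le (bound := fun _ => C)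
        (Metric.closedBall_mem_nhds x₀ one_pos) ?_ ?_ ?_ ?_ ?_ ?_
      · exact Filter.Eventually.of_forall fun x =>
          (hF.continuous.comp (by fun_prop : Continuous fun t : ℝ => (x, t))).aestronglyMeasurable
      · exact (hF.continuous.comp
          (by fun_prop : Continuous fun t : ℝ => (x₀, t))).intervalIntegrable _ _
      · exact (hcont.comp (by fun_prop : Continuous fun t : ℝ => (x₀, t))).aestronglyMeasurable
      · refine Filter.Eventually.of_forall fun t ht x hx => hC (x, t) ⟨hx, ?_⟩
        rw [Set.uIoc_of_le zero_le_one] at ht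
        exact ⟨ht.1.le, ht.2⟩
      · exact intervalIntegrable_const
      · exact Filter.Eventually.of_forall fun t _ x _ => hder x t
    rw [Nat.cast_add, Nat.cast_one, contDiff_succ_iff_hasFDerivAt]
    exact ⟨_, ih F' hF', hint⟩

/-- Hadamard's lemma: a smooth function on `ℝ^p` is, up to its value at a point `a`, a combination
of the functions `y i - a i` with smooth coefficients, whose values at `a` are the partial
derivatives. -/
theorem hadamard {p : ℕ} {f : EuclideanSpace ℝ (Fin p) → ℝ} (hf : ContDiff ℝ ∞ f)
    (a : EuclideanSpace ℝ (Fin p)) :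
    ∃ g : Fin p → EuclideanSpace ℝ (Fin p) → ℝ, (∀ i, ContDiff ℝ ∞ (g i)) ∧
      (∀ i, g i a = fderiv ℝ f a (EuclideanSpace.single i 1)) ∧
      ∀ y, f y = f a + ∑ i, (y i - a i) * g i y := by
  refine ⟨fun i y => ∫ t in (0 : ℝ)..1, fderiv ℝ f (a + t • (y - a)) (EuclideanSpace.single i 1),
    fun i => ?_, fun i => by simp, fun y => ?_⟩
  · rw [contDiff_infty]
    intro n
    refine contDiff_nat_integral_of_contDiff n _ ?_
    have h : ContDiff ℝ n (fderiv ℝ f) := (hf.fderiv_right (m := ∞) (by simp)).of_le (by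
      exact_mod_cast le_top)
    refine (h.comp (?_ : ContDiff ℝ n fun q : EuclideanSpace ℝ (Fin p) × ℝ =>
      a + q.2 • (q.1 - a))).clm_apply contDiff_const
    fun_prop
  · have hd : ∀ t : ℝ, HasDerivAt (fun t : ℝ => f (a + t • (y - a)))
        (fderiv ℝ f (a + t • (y - a)) (y - a)) t := by
      intro t
      have h1 : HasDerivAt (fun t : ℝ => a + t • (y - a)) (y - a) t := by
        simpa using ((hasDerivAt_id t).smul_const (y - a)).const_add a
      exact ((hf.differentiable (by simp)) _).hasFDerivAt.comp_hasDerivAt t h1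
    have hc : ∀ v, Continuous fun t : ℝ => fderiv ℝ f (a + t • (y - a)) v := by
      intro v
      have := hf.continuous_fderiv (by simp)
      fun_prop
    have hI := intervalIntegral.integral_eq_sub_of_hasDerivAt (a := 0) (b := 1)
      (fun t _ => hd t) ((hc _).intervalIntegrable _ _)
    have hv : y - a = ∑ i, (y i - a i) • EuclideanSpace.single i (1 : ℝ) := by
      ext j
      simp [Finset.sum_apply, Pi.single_apply]
    have hs : ∀ t : ℝ, fderiv ℝ f (a + t • (y - a)) (y - a) =
        ∑ i, (y i - a i) * fderiv ℝ f (a + t • (y - a)) (EuclideanSpace.single i 1) := by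
      intro t
      conv_lhs => rw [hv]
      rw [map_sum]
      simp only [map_smul, smul_eq_mul]
      rw [← hv]
    simp only [hs] at hI
    rw [intervalIntegral.integral_finsetSum
      fun i _ => ((hc _).const_mul _).intervalIntegrable _ _] at hI
    simp only [intervalIntegral.integral_const_mul] at hI
    rw [hI]
    simp

open Filter Topology in
/-- Smooth cutoff: near a point `a` of an open set a smooth function on that set is
the restriction of a smooth function on the whole space. -/
theorem exists_cutoff {p : ℕ} {W : Set (EuclideanSpace ℝ (Fin p))} (hW : IsOpen W)
    {a : EuclideanSpace ℝ (Fin p)} (ha : a ∈ W) :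
    ∃ χ : EuclideanSpace ℝ (Fin p) → ℝ, ContDiff ℝ ∞ χ ∧ χ =ᶠ[𝓝 a] 1 ∧
      ∀ f : EuclideanSpace ℝ (Fin p) → ℝ, ContDiffOn ℝ ∞ f W → ContDiff ℝ ∞ fun y => χ y * f y := by
  obtain ⟨r, hr, hrW⟩ := Metric.nhds_basis_closedBall.mem_iff.1 (hW.mem_nhds ha)
  let χ : ContDiffBump a := ⟨r / 2, r, by positivity, by linarith⟩
  refine ⟨χ, χ.contDiff, χ.eventuallyEq_one, fun f hf => ?_⟩
  rw [contDiff_iff_contDiffAt]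
  intro y
  by_cases hy : y ∈ tsupport χ
  · rw [χ.tsupport_eq] at hy
    exact χ.contDiff.contDiffAt.mul (hf.contDiffAt (hW.mem_nhds (hrW hy)))
  · have h0 : χ =ᶠ[𝓝 y] 0 := notMem_tsupport_iff_eventuallyEq.1 hy
    refine (contDiffAt_const (c := (0 : ℝ))).congr_of_eventuallyEq ?_
    filter_upwards [h0] with x hx
    simp [hx]

theorem parity_cases (i : ZMod 2) : i = 0 ∨ i = 1 := by
  revert i; decide

/-! ### Grassmann-valued functions -/

section GrassmannFunctions

variable {p q : ℕ}

/-- The basis of the Grassmann algebra given by the products of generators. -/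
noncomputable abbrev Grassmann.basis (q : ℕ) :
    Module.Basis (Finset (Fin q)) ℝ (Grassmann q) :=
  (Pi.basisFun ℝ (Fin q)).ExteriorAlgebra

/-- Smoothness on a set of a Grassmann-algebra-valued function: all linear functionals of it are
smooth. -/
def GSmoothOn (g : EuclideanSpace ℝ (Fin p) → Grassmann q) (W : Set (EuclideanSpace ℝ (Fin p))) :
    Prop :=
  ∀ l : Grassmann q →ₗ[ℝ] ℝ, ContDiffOn ℝ ∞ (fun y => l (g y)) W

/-- The derivative of a Grassmann-algebra-valued function at `y` in the direction `v`, taken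
componentwise. -/
noncomputable def gderiv (g : EuclideanSpace ℝ (Fin p) → Grassmann q)
    (v y : EuclideanSpace ℝ (Fin p)) : Grassmann q :=
  ∑ s, fderiv ℝ (fun y => (Grassmann.basis q).coord s (g y)) y v • Grassmann.basis q s

variable {g g' : EuclideanSpace ℝ (Fin p) → Grassmann q} {W : Set (EuclideanSpace ℝ (Fin p))}

theorem GSmoothOn.differentiableAt (hg : GSmoothOn g W) (hW : IsOpen W)
    {y : EuclideanSpace ℝ (Fin p)} (hy : y ∈ W) (l : Grassmann q →ₗ[ℝ] ℝ) :
    DifferentiableAt ℝ (fun y => l (g y)) y :=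
  ((hg l).contDiffAt (hW.mem_nhds hy)).differentiableAt (by simp)

/-- The derivative commutes with linear functionals. -/
theorem GSmoothOn.apply_gderiv (hg : GSmoothOn g W) (hW : IsOpen W)
    {y : EuclideanSpace ℝ (Fin p)} (hy : y ∈ W) (v : EuclideanSpace ℝ (Fin p))
    (l : Grassmann q →ₗ[ℝ] ℝ) :
    l (gderiv g v y) = fderiv ℝ (fun y => l (g y)) y v := by
  have e : (fun y => l (g y)) = fun y =>
      ∑ s, (Grassmann.basis q).coord s (g y) * l (Grassmann.basis q s) := by
    funext y
    conv_lhs => rw [← (Grassmann.basis q).sum_repr (g y), map_sum]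
    simp only [map_smul, smul_eq_mul, Module.Basis.coord_apply]
  rw [e, fderiv_fun_sum fun s _ => (hg.differentiableAt hW hy _).mul_const _]
  rw [gderiv, map_sum, sum_apply]
  refine Finset.sum_congr rfl fun s _ => ?_
  rw [fderiv_mul_const (hg.differentiableAt hW hy _)]
  simp [mul_comm]

theorem Grassmann.ext_functional {a b : Grassmann q} (h : ∀ l : Grassmann q →ₗ[ℝ] ℝ, l a = l b) :
    a = b :=
  (Grassmann.basis q).ext_elem fun s => h ((Grassmann.basis q).coord s)

theorem GSmoothOn.map (hg : GSmoothOn g W) (T : Grassmann q →ₗ[ℝ] Grassmann q) :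
    GSmoothOn (fun y => T (g y)) W :=
  fun l => hg (l ∘ₗ T)

theorem GSmoothOn.add (hg : GSmoothOn g W) (hg' : GSmoothOn g' W) :
    GSmoothOn (fun y => g y + g' y) W := fun l => by
  simpa using (hg l).add (hg' l)

theorem GSmoothOn.congr (hg : GSmoothOn g W) (h : ∀ y ∈ W, g' y = g y) : GSmoothOn g' W :=
  fun l => (hg l).congr fun y hy => by rw [h y hy]

theorem gSmoothOn_algebraMap {f : EuclideanSpace ℝ (Fin p) → ℝ} (hf : ContDiffOn ℝ ∞ f W) :
    GSmoothOn (fun y => algebraMap ℝ (Grassmann q) (f y)) W := fun l => by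
  simp only [Algebra.algebraMap_eq_smul_one, map_smul, smul_eq_mul]
  exact hf.mul contDiffOn_const

theorem gSmoothOn_const (w : Grassmann q) : GSmoothOn (fun _ => w) W := fun _ => contDiffOn_const

/-- The derivative commutes with linear maps. -/
theorem GSmoothOn.gderiv_map (hg : GSmoothOn g W) (hW : IsOpen W)
    {y : EuclideanSpace ℝ (Fin p)} (hy : y ∈ W) (v : EuclideanSpace ℝ (Fin p))
    (T : Grassmann q →ₗ[ℝ] Grassmann q) :
    gderiv (fun y => T (g y)) v y = T (gderiv g v y) :=
  Grassmann.ext_functional fun l => by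
    rw [(hg.map T).apply_gderiv hW hy, ← LinearMap.comp_apply, hg.apply_gderiv hW hy]
    rfl

theorem GSmoothOn.gderiv_add (hg : GSmoothOn g W) (hg' : GSmoothOn g' W) (hW : IsOpen W)
    {y : EuclideanSpace ℝ (Fin p)} (hy : y ∈ W) (v : EuclideanSpace ℝ (Fin p)) :
    gderiv (fun y => g y + g' y) v y = gderiv g v y + gderiv g' v y :=
  Grassmann.ext_functional fun l => by
    rw [(hg.add hg').apply_gderiv hW hy, map_add, hg.apply_gderiv hW hy, hg'.apply_gderiv hW hy]
    simp only [map_add]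
    rw [fderiv_fun_add (hg.differentiableAt hW hy l) (hg'.differentiableAt hW hy l)]
    rfl

theorem gderiv_algebraMap {f : EuclideanSpace ℝ (Fin p) → ℝ} (hf : ContDiffOn ℝ ∞ f W)
    (hW : IsOpen W) {y : EuclideanSpace ℝ (Fin p)} (hy : y ∈ W) (v : EuclideanSpace ℝ (Fin p)) :
    gderiv (fun y => algebraMap ℝ (Grassmann q) (f y)) v y = algebraMap ℝ _ (fderiv ℝ f y v) :=
  Grassmann.ext_functional fun l => by
    rw [(gSmoothOn_algebraMap hf).apply_gderiv hW hy]
    simp only [Algebra.algebraMap_eq_smul_one, map_smul, smul_eq_mul]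
    rw [fderiv_mul_const ((hf.contDiffAt (hW.mem_nhds hy)).differentiableAt (by simp))]
    simp [mul_comm]

theorem gderiv_congr (hW : IsOpen W) {y : EuclideanSpace ℝ (Fin p)} (hy : y ∈ W)
    (h : ∀ y ∈ W, g y = g' y) (v : EuclideanSpace ℝ (Fin p)) : gderiv g v y = gderiv g' v y := by
  refine Finset.sum_congr rfl fun s _ => ?_
  congr 2
  refine Filter.EventuallyEq.fderiv_eq ?_
  filter_upwards [hW.mem_nhds hy] with x hx
  rw [h x hx]

theorem GSmoothOn.gderiv (hg : GSmoothOn g W) (hW : IsOpen W) (v : EuclideanSpace ℝ (Fin p)) :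
    GSmoothOn (gderiv g v) W := fun l => by
  refine ContDiffOn.congr (f := fun y => fderiv ℝ (fun y => l (g y)) y v) ?_
    fun y hy => hg.apply_gderiv hW hy v l
  exact ((hg l).fderiv_of_isOpen hW (m := ∞) (by simp)).clm_apply contDiffOn_const

/-- Second derivatives are symmetric. -/
theorem GSmoothOn.gderiv_comm (hg : GSmoothOn g W) (hW : IsOpen W)
    {y : EuclideanSpace ℝ (Fin p)} (hy : y ∈ W) (v w : EuclideanSpace ℝ (Fin p)) :
    Super.gderiv (Super.gderiv g v) w y = Super.gderiv (Super.gderiv g w) v y :=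
  Grassmann.ext_functional fun l => by
    have key : ∀ v w, l (Super.gderiv (Super.gderiv g v) w y) =
        fderiv ℝ (fderiv ℝ (fun y => l (g y))) y w v := by
      intro v w
      rw [(hg.gderiv hW v).apply_gderiv hW hy]
      have e : (fun y => l (Super.gderiv g v y)) =ᶠ[nhds y]
          fun y => fderiv ℝ (fun y => l (g y)) y v := by
        filter_upwards [hW.mem_nhds hy] with x hx using hg.apply_gderiv hW hx v l
      have hd : DifferentiableAt ℝ (fderiv ℝ (fun y => l (g y))) y :=
        (((hg l).fderiv_of_isOpen hW (m := ∞) (by simp)).contDiffAt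
          (hW.mem_nhds hy)).differentiableAt (by simp)
      rw [e.fderiv_eq, fderiv_clm_apply hd (differentiableAt_const v)]
      simp
    rw [key, key]
    exact (((hg l).contDiffAt (hW.mem_nhds hy)).isSymmSndFDerivAt (by
      simp only [minSmoothness_of_isRCLikeNormedField]; exact WithTop.coe_le_coe.2 le_top)).eq w v

end GrassmannFunctions

/-! ### Contractions of the Grassmann algebra -/

namespace Grassmann

variable {q : ℕ}

/-- The generator `θ_j` of the Grassmann algebra. -/
noncomputable def θ (j : Fin q) : Grassmann q := ExteriorAlgebra.ι ℝ (Pi.single j 1)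

/-- The left derivative with respect to the generator `θ_j`. -/
noncomputable def contract (j : Fin q) : Grassmann q →ₗ[ℝ] Grassmann q :=
  CliffordAlgebra.contractLeft (LinearMap.proj j)

theorem contract_ι_mul (j : Fin q) (v : Fin q → ℝ) (w : Grassmann q) :
    contract j (ExteriorAlgebra.ι ℝ v * w) = v j • w - ExteriorAlgebra.ι ℝ v * contract j w :=
  CliffordAlgebra.contractLeft_ι_mul (Q := (0 : QuadraticForm ℝ (Fin q → ℝ))) (LinearMap.proj j) v w

theorem contract_θ_mul (j k : Fin q) (w : Grassmann q) :
    contract j (θ k * w) = (if j = k then w else 0) - θ k * contract j w := by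
  rw [θ, contract_ι_mul, Pi.single_apply]
  split_ifs <;> simp

theorem contract_algebraMap (j : Fin q) (r : ℝ) : contract j (algebraMap ℝ _ r) = 0 :=
  CliffordAlgebra.contractLeft_algebraMap (Q := (0 : QuadraticForm ℝ (Fin q → ℝ)))
    (LinearMap.proj j) r

theorem contract_ι (j : Fin q) (v : Fin q → ℝ) :
    contract j (ExteriorAlgebra.ι ℝ v) = algebraMap ℝ _ (v j) :=
  CliffordAlgebra.contractLeft_ι (Q := (0 : QuadraticForm ℝ (Fin q → ℝ))) (LinearMap.proj j) v

theorem contract_comm (j k : Fin q) (w : Grassmann q) :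
    contract j (contract k w) = -contract k (contract j w) :=
  CliffordAlgebra.contractLeft_comm (Q := (0 : QuadraticForm ℝ (Fin q → ℝ))) _ _ w

theorem ι_eq_sum (v : Fin q → ℝ) : ExteriorAlgebra.ι ℝ v = ∑ j, v j • θ j := by
  conv_lhs => rw [← Finset.univ_sum_single v, map_sum]
  refine Finset.sum_congr rfl fun j _ => ?_
  rw [θ, ← map_smul, ← Pi.single_smul, smul_eq_mul, mul_one]

/-- Induction on elements of the Grassmann algebra, multiplying by vectors from the left. -/
theorem left_induction {P : Grassmann q → Prop} (algebraMap : ∀ r : ℝ, P (algebraMap ℝ _ r))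
    (add : ∀ x y, P x → P y → P (x + y))
    (ι_mul : ∀ v x, P x → P (ExteriorAlgebra.ι ℝ v * x)) (x : Grassmann q) : P x :=
  CliffordAlgebra.left_induction (Q := (0 : QuadraticForm ℝ (Fin q → ℝ))) algebraMap add
    (fun x v h => ι_mul v x h) x

/-- An element all of whose derivatives vanish is a scalar. The operator `w ↦ ∂_j (θ_j w)` sets
`θ_j` to zero and fixes `w` if `∂_j w = 0`, and setting all generators to zero leaves a scalar. -/
theorem eq_algebraMap_of_contract_eq_zero {w : Grassmann q} (h : ∀ j, contract j w = 0) :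
    w = algebraMap ℝ _ (ExteriorAlgebra.algebraMapInv w) := by
  -- the projection which sets the generators in a finite set to zero
  let P : Finset (Fin q) → (Fin q → ℝ) →ₗ[ℝ] (Fin q → ℝ) := fun J =>
    LinearMap.pi fun j => if j ∈ J then 0 else LinearMap.proj j
  have single : ∀ j w, ExteriorAlgebra.map (P {j}) w = contract j (θ j * w) := by
    intro j w
    induction w using left_induction with
    | algebraMap r => rw [contract_θ_mul, contract_algebraMap]; simp
    | add x y hx hy => rw [map_add, hx, hy, mul_add, map_add]
    | ι_mul v x hx =>
      have e : P {j} v = v - v j • Pi.single j 1 := by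
        ext k
        by_cases hk : k = j
        · subst hk; simp [P]
        · simp [P, hk]
      rw [map_mul, hx, ExteriorAlgebra.map_apply_ι, e, contract_θ_mul, contract_θ_mul,
        contract_ι_mul, map_sub, map_smul, ← θ]
      have e2 : ExteriorAlgebra.ι ℝ v * θ j = -(θ j * ExteriorAlgebra.ι ℝ v) :=
        eq_neg_of_add_eq_zero_left (ExteriorAlgebra.ι_add_mul_swap v (Pi.single j 1))
      have e3 : θ j * θ j = 0 := ExteriorAlgebra.ι_sq_zero _
      simp only [if_true, mul_sub, sub_mul, smul_mul_assoc, mul_smul_comm, ← mul_assoc, e2, e3]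
      simp only [neg_mul, sub_neg_eq_add, zero_mul, smul_zero, sub_zero]
      abel
  have all : ∀ J : Finset (Fin q), ExteriorAlgebra.map (P J) w = w := by
    intro J
    induction J using Finset.induction_on with
    | empty =>
      have e : P ∅ = LinearMap.id := by ext v; simp [P]
      rw [e, ExteriorAlgebra.map_id, AlgHom.id_apply]
    | insert j J _ ih =>
      have e : P (insert j J) = P J ∘ₗ P {j} := by
        refine LinearMap.ext fun v => funext fun k => ?_
        by_cases hk : k = j
        · subst hk; by_cases hkJ : k ∈ J <;> simp [P, hkJ]
        · by_cases hkJ : k ∈ J <;> simp [P, hk, hkJ]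
      rw [e, ← ExteriorAlgebra.map_comp_map, AlgHom.comp_apply, single, contract_θ_mul, h]
      simpa using ih
  have e : P Finset.univ = 0 := by
    refine LinearMap.ext fun v => funext fun k => ?_
    simp [P]
  have zero : ∀ w : Grassmann q, ExteriorAlgebra.map (0 : (Fin q → ℝ) →ₗ[ℝ] (Fin q → ℝ)) w =
      algebraMap ℝ _ (ExteriorAlgebra.algebraMapInv w) := by
    intro w
    induction w using left_induction with
    | algebraMap r => simp
    | add x y hx hy => simp only [map_add, hx, hy]
    | ι_mul v x hx =>
      have : ExteriorAlgebra.algebraMapInv (ExteriorAlgebra.ι ℝ v) = 0 := by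
        simp [ExteriorAlgebra.algebraMapInv]
      simp [this]
  rw [← zero, ← e, all]

theorem ι_mem (v : Fin q → ℝ) : ExteriorAlgebra.ι ℝ v ∈ part q 1 :=
  CliffordAlgebra.ι_mem_evenOdd_one _ _

theorem θ_mem (j : Fin q) : θ j ∈ part q 1 := ι_mem _

theorem algebraMap_mem (r : ℝ) : algebraMap ℝ (Grassmann q) r ∈ part q 0 :=
  SetLike.algebraMap_mem_graded (CliffordAlgebra.evenOdd (0 : QuadraticForm ℝ (Fin q → ℝ))) r

theorem mul_mem {i j : ZMod 2} {a b : Grassmann q} (ha : a ∈ part q i) (hb : b ∈ part q j) :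
    a * b ∈ part q (i + j) :=
  SetLike.mul_mem_graded (A := CliffordAlgebra.evenOdd (0 : QuadraticForm ℝ (Fin q → ℝ))) ha hb

theorem contract_mem (j : Fin q) {i : ZMod 2} {w : Grassmann q} (hw : w ∈ part q i) :
    contract j w ∈ part q (i + 1) := by
  have step : ∀ (i : ZMod 2) (v v' : Fin q → ℝ) (x : Grassmann q), x ∈ part q i →
      contract j x ∈ part q (i + 1) →
      contract j (ExteriorAlgebra.ι ℝ v * ExteriorAlgebra.ι ℝ v' * x) ∈ part q (i + 1) := by
    intro i v v' x hx h
    rw [mul_assoc, contract_ι_mul, contract_ι_mul]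
    refine Submodule.sub_mem _ (Submodule.smul_mem _ _ ?_) ?_
    · rw [add_comm i]
      exact mul_mem (ι_mem _) hx
    · rw [mul_sub, mul_smul_comm]
      refine Submodule.sub_mem _ (Submodule.smul_mem _ _ ?_) ?_
      · rw [add_comm i]
        exact mul_mem (ι_mem _) hx
      · have := mul_mem (ι_mem v) (mul_mem (ι_mem v') h)
        rwa [← add_assoc, CharTwo.add_self_eq_zero, zero_add] at this
  rcases parity_cases i with rfl | rfl
  · refine CliffordAlgebra.even_induction (Q := (0 : QuadraticForm ℝ (Fin q → ℝ)))
      (motive := fun x _ => contract j x ∈ part q (0 + 1)) ?_ ?_ ?_ w hw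
    · intro r
      erw [contract_algebraMap]
      exact Submodule.zero_mem _
    · intro x y _ _ hx hy
      rw [map_add]
      exact Submodule.add_mem _ hx hy
    · intro v v' x hx h
      exact step 0 v v' x hx h
  · refine CliffordAlgebra.odd_induction (Q := (0 : QuadraticForm ℝ (Fin q → ℝ)))
      (P := fun x _ => contract j x ∈ part q (1 + 1)) ?_ ?_ ?_ w hw
    · intro v
      erw [contract_ι]
      exact algebraMap_mem _
    · intro x y _ _ hx hy
      rw [map_add]
      exact Submodule.add_mem _ hx hy
    · intro v v' x hx h
      exact step 1 v v' x hx h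

theorem isCompl_part (i : ZMod 2) : IsCompl (part q i) (part q (i + 1)) := by
  rcases parity_cases i with rfl | rfl
  · exact CliffordAlgebra.evenOdd_isCompl (Q := (0 : QuadraticForm ℝ (Fin q → ℝ)))
  · exact (CliffordAlgebra.evenOdd_isCompl (Q := (0 : QuadraticForm ℝ (Fin q → ℝ)))).symm

/-- The derivative of a function with values of a given parity has the same parity. -/
theorem gderiv_mem {p : ℕ} {g : EuclideanSpace ℝ (Fin p) → Grassmann q}
    {W : Set (EuclideanSpace ℝ (Fin p))} (hg : GSmoothOn g W) (hW : IsOpen W)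
    {y : EuclideanSpace ℝ (Fin p)} (hy : y ∈ W) (v : EuclideanSpace ℝ (Fin p)) {i : ZMod 2}
    (h : ∀ y ∈ W, g y ∈ part q i) : gderiv g v y ∈ part q i := by
  let T := (part q i).projection _ (isCompl_part i)
  have e : gderiv g v y = T (gderiv g v y) := by
    rw [← hg.gderiv_map hW hy]
    exact gderiv_congr hW hy
      (fun x hx => (Submodule.projection_apply_of_mem_left (isCompl_part i) (h x hx)).symm) v
  rw [e]
  exact Submodule.projection_apply_mem _ _

end Grassmann

/-! ### Sections as Grassmann-valued functions of the coordinates -/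

namespace SuperChart

variable {M : Type u} [TopologicalSpace M] {p q : ℕ} [ChartedSpace (EuclideanSpace ℝ (Fin p)) M]
  {O : SuperPresheaf.{u, v} M} (c : SuperChart p q O) {U V : Opens M}

/-- The open subset of `ℝ^p` that corresponds to `V` in the chart of the underlying manifold. -/
def img (V : Opens M) : Set (EuclideanSpace ℝ (Fin p)) := c.chart.target ∩ c.chart.symm ⁻¹' V

theorem isOpen_img (V : Opens M) : IsOpen (c.img V) :=
  c.chart.isOpen_inter_preimage_symm V.isOpen

theorem img_mono (h : U ≤ V) : c.img U ⊆ c.img V := fun _ hy => ⟨hy.1, h hy.2⟩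

theorem chart_mem_img (h : V ≤ c.dom) {x : M} (hx : x ∈ V) : c.chart x ∈ c.img V :=
  ⟨c.chart.map_source (c.dom_subset (h hx)), by
    rw [Set.mem_preimage, c.chart.left_inv (c.dom_subset (h hx))]; exact hx⟩

open Classical in
/-- A section in a superchart, as a Grassmann-algebra-valued function of the even coordinates. It is
extended by zero outside of the image of the chart. -/
noncomputable def eval (h : V ≤ c.dom) : O.Sec V →ₗ[ℝ] EuclideanSpace ℝ (Fin p) → Grassmann q where
  toFun F y := if hy : c.chart.symm y ∈ V then (c.triv V h F).1 ⟨_, hy⟩ else 0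
  map_add' F G := by
    funext y
    by_cases hy : c.chart.symm y ∈ V <;> simp [hy]
  map_smul' r F := by
    funext y
    by_cases hy : c.chart.symm y ∈ V <;> simp [hy]

theorem eval_of_mem (h : V ≤ c.dom) (F : O.Sec V) {y : EuclideanSpace ℝ (Fin p)}
    (hy : y ∈ c.img V) : c.eval h F y = (c.triv V h F).1 ⟨c.chart.symm y, hy.2⟩ :=
  dif_pos hy.2

theorem eval_chart (h : V ≤ c.dom) (F : O.Sec V) (x : V) :
    c.eval h F (c.chart x) = (c.triv V h F).1 x := by
  rw [c.eval_of_mem h F (c.chart_mem_img h x.2)]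
  exact congrArg _ (Subtype.ext (c.chart.left_inv (c.dom_subset (h x.2))))

theorem eval_mul (h : V ≤ c.dom) (F G : O.Sec V) : c.eval h (F * G) = c.eval h F * c.eval h G := by
  funext y
  by_cases hy : c.chart.symm y ∈ V <;> simp [eval, hy]

theorem eval_algebraMap (h : V ≤ c.dom) (r : ℝ) {y : EuclideanSpace ℝ (Fin p)}
    (hy : y ∈ c.img V) : c.eval h (algebraMap ℝ (O.Sec V) r) y = algebraMap ℝ _ r := by
  rw [eval_of_mem _ _ _ hy, AlgEquiv.commutes]
  rfl

theorem eval_res (h : U ≤ V) (k : V ≤ c.dom) (F : O.Sec V) {y : EuclideanSpace ℝ (Fin p)}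
    (hy : y ∈ c.img U) : c.eval (h.trans k) (O.res h F) y = c.eval k F y := by
  rw [eval_of_mem _ _ _ hy, eval_of_mem _ _ _ (c.img_mono h hy)]
  exact c.triv_res U V h k F ⟨_, hy.2⟩

theorem eval_ext (h : V ≤ c.dom) {F G : O.Sec V}
    (e : ∀ y ∈ c.img V, c.eval h F y = c.eval h G y) : F = G := by
  refine (c.triv V h).injective (Subtype.ext (funext fun x => ?_))
  rw [← eval_chart, ← eval_chart, e _ (c.chart_mem_img h x.2)]

theorem mem_part_iff (h : V ≤ c.dom) {i : ZMod 2} {F : O.Sec V} :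
    F ∈ O.part V i ↔ ∀ y ∈ c.img V, c.eval h F y ∈ Grassmann.part q i := by
  rw [c.triv_mem V h]
  constructor
  · intro H y hy
    rw [eval_of_mem _ _ _ hy]
    exact H _
  · intro H x
    rw [← eval_chart]
    exact H _ (c.chart_mem_img h x.2)

theorem gSmoothOn_eval (h : V ≤ c.dom) (F : O.Sec V) : GSmoothOn (c.eval h F) (c.img V) := by
  intro l y hy
  have h1 : ContMDiffAt 𝓘(ℝ, EuclideanSpace ℝ (Fin p)) 𝓘(ℝ, ℝ) ∞
      (fun x : V => l (c.eval h F (c.chart x))) ⟨_, hy.2⟩ := by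
    simp only [eval_chart]
    exact (c.triv V h F).2 l _
  have h2 := (contMDiffAt_subtype_iff (f := fun x : M => l (c.eval h F (c.chart x)))).1 h1
  have h3 := ((contMDiffOn_symm_of_mem_maximalAtlas c.chart_mem).contMDiffAt
    (c.chart.open_target.mem_nhds hy.1))
  have h4 := (h2.comp y h3).contDiffAt
  refine (h4.congr_of_eventuallyEq ?_).contDiffWithinAt
  filter_upwards [c.chart.open_target.mem_nhds hy.1] with x hx
  simp [c.chart.right_inv hx]

/-- The section with a given smooth coordinate expression. -/
noncomputable def ofFun (h : V ≤ c.dom) (g : EuclideanSpace ℝ (Fin p) → Grassmann q)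
    (hg : GSmoothOn g (c.img V)) : O.Sec V :=
  (c.triv V h).symm ⟨fun x => g (c.chart x), fun l x => by
    have h1 : ContMDiffAt 𝓘(ℝ, EuclideanSpace ℝ (Fin p)) 𝓘(ℝ, ℝ) ∞ (fun y => l (g y))
        (c.chart x) :=
      ((hg l).contDiffAt ((c.isOpen_img V).mem_nhds (c.chart_mem_img h x.2))).contMDiffAt
    have h2 : ContMDiffAt 𝓘(ℝ, EuclideanSpace ℝ (Fin p)) 𝓘(ℝ, EuclideanSpace ℝ (Fin p)) ∞
        (fun x : V => c.chart x) x :=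
      ((contMDiffOn_of_mem_maximalAtlas c.chart_mem).contMDiffAt
        (c.chart.open_source.mem_nhds (c.dom_subset (h x.2)))).comp x (contMDiff_subtype_val x)
    exact ContMDiffAt.comp (g := fun y => l (g y)) (f := fun x : V => c.chart x) x h1 h2⟩

theorem eval_ofFun (h : V ≤ c.dom) {g : EuclideanSpace ℝ (Fin p) → Grassmann q}
    (hg : GSmoothOn g (c.img V)) {y : EuclideanSpace ℝ (Fin p)} (hy : y ∈ c.img V) :
    c.eval h (c.ofFun h g hg) y = g y := by
  rw [eval_of_mem _ _ _ hy, ofFun, AlgEquiv.apply_symm_apply]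
  simp [c.chart.right_inv hy.1]

/-- The parity of a coordinate. -/
def parity : Fin p ⊕ Fin q → ZMod 2 := Sum.elim (fun _ => 0) (fun _ => 1)

theorem eval_coord_inl (h : V ≤ c.dom) (i : Fin p) {y : EuclideanSpace ℝ (Fin p)}
    (hy : y ∈ c.img V) :
    c.eval h (O.res h (c.coord (Sum.inl i))) y = algebraMap ℝ _ (y i) := by
  rw [c.eval_res h le_rfl _ hy, eval_of_mem _ _ _ (c.img_mono h hy), coord,
    AlgEquiv.apply_symm_apply]
  simp [c.chart.right_inv hy.1]

theorem eval_coord_inr (h : V ≤ c.dom) (j : Fin q) {y : EuclideanSpace ℝ (Fin p)}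
    (hy : y ∈ c.img V) :
    c.eval h (O.res h (c.coord (Sum.inr j))) y = Grassmann.θ j := by
  rw [c.eval_res h le_rfl _ hy, eval_of_mem _ _ _ (c.img_mono h hy), coord,
    AlgEquiv.apply_symm_apply]
  rfl

theorem coord_mem (h : V ≤ c.dom) (a : Fin p ⊕ Fin q) :
    O.res h (c.coord a) ∈ O.part V (parity a) := by
  rw [c.mem_part_iff h]
  intro y hy
  rcases a with i | j
  · rw [c.eval_coord_inl h i hy]
    exact Grassmann.algebraMap_mem _
  · rw [c.eval_coord_inr h j hy]
    exact Grassmann.θ_mem _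

/-- The (left) partial derivatives of sections with respect to the coordinates. -/
noncomputable def pderiv (h : V ≤ c.dom) : Fin p ⊕ Fin q → O.Sec V →ₗ[ℝ] O.Sec V
  | Sum.inl i =>
    { toFun := fun F => c.ofFun h (gderiv (c.eval h F) (EuclideanSpace.single i 1))
        ((c.gSmoothOn_eval h F).gderiv (c.isOpen_img V) _)
      map_add' := fun F G => c.eval_ext h fun y hy => by
        rw [eval_ofFun _ _ _ hy, map_add, map_add, Pi.add_apply, eval_ofFun _ _ _ hy,
          eval_ofFun _ _ _ hy]
        exact (c.gSmoothOn_eval h F).gderiv_add (c.gSmoothOn_eval h G) (c.isOpen_img V) hy _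
      map_smul' := fun r F => c.eval_ext h fun y hy => by
        rw [RingHom.id_apply, eval_ofFun _ _ _ hy, map_smul, map_smul, Pi.smul_apply,
          eval_ofFun _ _ _ hy]
        exact (c.gSmoothOn_eval h F).gderiv_map (c.isOpen_img V) hy _
          (r • (LinearMap.id : Grassmann q →ₗ[ℝ] Grassmann q)) }
  | Sum.inr j =>
    { toFun := fun F => c.ofFun h (fun y => Grassmann.contract j (c.eval h F y))
        ((c.gSmoothOn_eval h F).map _)
      map_add' := fun F G => c.eval_ext h fun y hy => by
        rw [eval_ofFun _ _ _ hy, map_add, map_add, Pi.add_apply, Pi.add_apply,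
          eval_ofFun _ _ _ hy, eval_ofFun _ _ _ hy, map_add]
      map_smul' := fun r F => c.eval_ext h fun y hy => by
        rw [RingHom.id_apply, eval_ofFun _ _ _ hy, map_smul, map_smul, Pi.smul_apply, Pi.smul_apply,
          eval_ofFun _ _ _ hy, map_smul] }

theorem eval_pderiv_inl (h : V ≤ c.dom) (i : Fin p) (F : O.Sec V)
    {y : EuclideanSpace ℝ (Fin p)} (hy : y ∈ c.img V) :
    c.eval h (c.pderiv h (Sum.inl i) F) y = gderiv (c.eval h F) (EuclideanSpace.single i 1) y :=
  c.eval_ofFun h ((c.gSmoothOn_eval h F).gderiv (c.isOpen_img V) _) hy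

theorem eval_pderiv_inr (h : V ≤ c.dom) (j : Fin q) (F : O.Sec V)
    {y : EuclideanSpace ℝ (Fin p)} (hy : y ∈ c.img V) :
    c.eval h (c.pderiv h (Sum.inr j) F) y = Grassmann.contract j (c.eval h F y) :=
  c.eval_ofFun h ((c.gSmoothOn_eval h F).map (Grassmann.contract j)) hy

theorem pderiv_mem (h : V ≤ c.dom) (a : Fin p ⊕ Fin q) {i : ZMod 2} {F : O.Sec V}
    (hF : F ∈ O.part V i) : c.pderiv h a F ∈ O.part V (i + parity a) := by
  rw [c.mem_part_iff h] at hF ⊢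
  intro y hy
  rcases a with k | j
  · rw [c.eval_pderiv_inl h k F hy]
    simpa [parity] using
      Grassmann.gderiv_mem (c.gSmoothOn_eval h F) (c.isOpen_img V) hy _ hF
  · rw [c.eval_pderiv_inr h j F hy]
    exact Grassmann.contract_mem j (hF y hy)

/-- The partial derivatives commute in the graded sense. -/
theorem pderiv_comm (h : V ≤ c.dom) (a b : Fin p ⊕ Fin q) (F : O.Sec V) :
    c.pderiv h a (c.pderiv h b F) =
      ((-1 : ℤˣ) ^ (parity a * parity b)) • c.pderiv h b (c.pderiv h a F) := by
  have mixed : ∀ i j, c.pderiv h (Sum.inl i) (c.pderiv h (Sum.inr j) F) =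
      c.pderiv h (Sum.inr j) (c.pderiv h (Sum.inl i) F) := by
    intro i j
    refine c.eval_ext h fun y hy => ?_
    rw [eval_pderiv_inl _ _ _ _ hy, eval_pderiv_inr _ _ _ _ hy, eval_pderiv_inl _ _ _ _ hy,
      ← (c.gSmoothOn_eval h F).gderiv_map (c.isOpen_img V) hy]
    exact gderiv_congr (c.isOpen_img V) hy (fun x hx => c.eval_pderiv_inr h j F hx) _
  rcases a with i | j <;> rcases b with k | l
  · simp only [parity, Sum.elim_inl, mul_zero, uzpow_zero, one_smul]
    refine c.eval_ext h fun y hy => ?_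
    rw [eval_pderiv_inl _ _ _ _ hy, eval_pderiv_inl _ _ _ _ hy,
      gderiv_congr (c.isOpen_img V) hy (fun x hx => c.eval_pderiv_inl h k F hx),
      gderiv_congr (c.isOpen_img V) hy (fun x hx => c.eval_pderiv_inl h i F hx)]
    exact (c.gSmoothOn_eval h F).gderiv_comm (c.isOpen_img V) hy _ _
  · simp [parity, mixed]
  · simp [parity, mixed]
  · simp only [parity, Sum.elim_inr, mul_one, uzpow_one, Units.neg_smul, one_smul]
    refine c.eval_ext h fun y hy => ?_
    rw [map_neg, Pi.neg_apply, eval_pderiv_inr _ _ _ _ hy, eval_pderiv_inr _ _ _ _ hy,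
      eval_pderiv_inr _ _ _ _ hy, eval_pderiv_inr _ _ _ _ hy, Grassmann.contract_comm]

end SuperChart

/-! ### Derivations in coordinates -/

variable {M : Type u} [TopologicalSpace M]

/-- A graded (left) derivation of parity `δ` of the algebra of sections over a fixed open set. -/
structure IsGradedDerivation (O : SuperPresheaf.{u, v} M) (V : Opens M) (δ : ZMod 2)
    (D : O.Sec V →ₗ[ℝ] O.Sec V) : Prop where
  mem : ∀ {i} {F : O.Sec V}, F ∈ O.part V i → D F ∈ O.part V (i + δ)
  leibniz : ∀ {i} {F : O.Sec V}, F ∈ O.part V i → ∀ G : O.Sec V,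
    D (F * G) = D F * G + ((-1 : ℤˣ) ^ (δ * i)) • (F * D G)

namespace IsGradedDerivation

variable {O : SuperPresheaf.{u, v} M} {V : Opens M} {δ : ZMod 2} {D : O.Sec V →ₗ[ℝ] O.Sec V}

theorem map_one (hD : IsGradedDerivation O V δ D) : D 1 = 0 := by
  have := hD.leibniz (O.one_mem V) 1
  simpa using this

theorem map_algebraMap (hD : IsGradedDerivation O V δ D) (r : ℝ) :
    D (algebraMap ℝ _ r) = 0 := by
  rw [Algebra.algebraMap_eq_smul_one, map_smul, hD.map_one, smul_zero]

theorem leibniz_even (hD : IsGradedDerivation O V δ D) {F : O.Sec V} (hF : F ∈ O.part V 0)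
    (G : O.Sec V) : D (F * G) = D F * G + F * D G := by
  simpa using hD.leibniz hF G

end IsGradedDerivation

namespace SuperChart

variable {p q : ℕ} [ChartedSpace (EuclideanSpace ℝ (Fin p)) M]
  {O : SuperPresheaf.{u, v} M} (c : SuperChart p q O) {V : Opens M}

/-- The even section given by a smooth real-valued function of the even coordinates. -/
noncomputable def scalar (h : V ≤ c.dom) (f : EuclideanSpace ℝ (Fin p) → ℝ)
    (hf : ContDiffOn ℝ ∞ f (c.img V)) : O.Sec V :=
  c.ofFun h (fun y => algebraMap ℝ _ (f y)) (gSmoothOn_algebraMap hf)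

theorem eval_scalar (h : V ≤ c.dom) {f : EuclideanSpace ℝ (Fin p) → ℝ}
    (hf : ContDiffOn ℝ ∞ f (c.img V)) {y : EuclideanSpace ℝ (Fin p)} (hy : y ∈ c.img V) :
    c.eval h (c.scalar h f hf) y = algebraMap ℝ _ (f y) :=
  c.eval_ofFun h (gSmoothOn_algebraMap hf) hy

theorem scalar_mem (h : V ≤ c.dom) {f : EuclideanSpace ℝ (Fin p) → ℝ}
    (hf : ContDiffOn ℝ ∞ f (c.img V)) : c.scalar h f hf ∈ O.part V 0 :=
  (c.mem_part_iff h).2 fun y hy => by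
    rw [c.eval_scalar h hf hy]; exact Grassmann.algebraMap_mem _

/-- The section with constant value in the Grassmann algebra. -/
noncomputable def const (h : V ≤ c.dom) (w : Grassmann q) : O.Sec V :=
  c.ofFun h (fun _ => w) (gSmoothOn_const w)

theorem eval_const (h : V ≤ c.dom) (w : Grassmann q) {y : EuclideanSpace ℝ (Fin p)}
    (hy : y ∈ c.img V) : c.eval h (c.const h w) y = w :=
  c.eval_ofFun h (gSmoothOn_const w) hy

variable {δ : ZMod 2} {D : O.Sec V →ₗ[ℝ] O.Sec V}

/-- By Hadamard's lemma, a derivation satisfies the chain rule on functions of the even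
coordinates that are smooth on all of `ℝ^p`. -/
theorem eval_derivation_scalar_of_contDiff (hD : IsGradedDerivation O V δ D) (h : V ≤ c.dom)
    {f : EuclideanSpace ℝ (Fin p) → ℝ} (hf : ContDiff ℝ ∞ f) {a : EuclideanSpace ℝ (Fin p)}
    (ha : a ∈ c.img V) :
    c.eval h (D (c.scalar h f hf.contDiffOn)) a =
      ∑ i, fderiv ℝ f a (EuclideanSpace.single i 1) •
        c.eval h (D (O.res h (c.coord (Sum.inl i)))) a := by
  obtain ⟨g, hg, hga, hfg⟩ := hadamard hf a
  have e : c.scalar h f hf.contDiffOn = algebraMap ℝ _ (f a) +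
      ∑ i, (O.res h (c.coord (Sum.inl i)) - algebraMap ℝ _ (a i)) *
        c.scalar h (g i) (hg i).contDiffOn := by
    refine c.eval_ext h fun y hy => ?_
    rw [map_add, map_sum, Pi.add_apply, Finset.sum_apply, c.eval_scalar h _ hy,
      c.eval_algebraMap h _ hy, hfg y, map_add, map_sum]
    congr 1
    refine Finset.sum_congr rfl fun i _ => ?_
    rw [eval_mul, Pi.mul_apply, map_sub, Pi.sub_apply, c.eval_coord_inl h i hy,
      c.eval_algebraMap h _ hy, c.eval_scalar h _ hy, map_mul, map_sub]
  rw [e, map_add, hD.map_algebraMap, zero_add, map_sum, map_sum, Finset.sum_apply]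
  refine Finset.sum_congr rfl fun i _ => ?_
  have hmem : O.res h (c.coord (Sum.inl i)) - algebraMap ℝ _ (a i) ∈ O.part V 0 := by
    refine Submodule.sub_mem _ (c.coord_mem h (Sum.inl i)) ?_
    rw [Algebra.algebraMap_eq_smul_one]
    exact Submodule.smul_mem _ _ (O.one_mem V)
  rw [hD.leibniz_even hmem, map_sub, hD.map_algebraMap, sub_zero, map_add, Pi.add_apply, eval_mul,
    eval_mul, Pi.mul_apply, Pi.mul_apply, map_sub, Pi.sub_apply, c.eval_coord_inl h i ha,
    c.eval_algebraMap h _ ha, sub_self, zero_mul, add_zero, c.eval_scalar h _ ha, hga,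
    ← Algebra.commutes, ← Algebra.smul_def]

/-- The chain rule for a derivation on functions of the even coordinates. A cutoff function
reduces it to functions defined on all of `ℝ^p`. -/
theorem eval_derivation_scalar (hD : IsGradedDerivation O V δ D) (h : V ≤ c.dom)
    {f : EuclideanSpace ℝ (Fin p) → ℝ} (hf : ContDiffOn ℝ ∞ f (c.img V))
    {a : EuclideanSpace ℝ (Fin p)} (ha : a ∈ c.img V) :
    c.eval h (D (c.scalar h f hf)) a =
      ∑ i, fderiv ℝ f a (EuclideanSpace.single i 1) •
        c.eval h (D (O.res h (c.coord (Sum.inl i)))) a := by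
  obtain ⟨χ, hχ, hχ1, hχf⟩ := exists_cutoff (c.isOpen_img V) ha
  have e : c.scalar h (fun y => χ y * f y) (hχf f hf).contDiffOn =
      c.scalar h χ hχ.contDiffOn * c.scalar h f hf := by
    refine c.eval_ext h fun y hy => ?_
    rw [eval_mul, Pi.mul_apply, c.eval_scalar h _ hy, c.eval_scalar h _ hy, c.eval_scalar h _ hy,
      map_mul]
  have h1 : fderiv ℝ χ a = 0 := by
    rw [hχ1.fderiv_eq]
    exact fderiv_const_apply 1
  have h2 : fderiv ℝ (fun y => χ y * f y) a = fderiv ℝ f a := by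
    refine Filter.EventuallyEq.fderiv_eq ?_
    filter_upwards [hχ1] with y hy
    simp [hy]
  have key := c.eval_derivation_scalar_of_contDiff hD h (hχf f hf) ha
  rw [e, hD.leibniz_even (c.scalar_mem h _), map_add, Pi.add_apply, eval_mul, eval_mul,
    Pi.mul_apply, Pi.mul_apply, c.eval_derivation_scalar_of_contDiff hD h hχ ha, h1, h2,
    c.eval_scalar h hχ.contDiffOn ha, hχ1.eq_of_nhds] at key
  simpa using key

/-- The values of a derivation on constant sections are determined by those on the odd
coordinates. -/
theorem eval_derivation_const (hD : IsGradedDerivation O V δ D) (h : V ≤ c.dom) (w : Grassmann q)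
    {a : EuclideanSpace ℝ (Fin p)} (ha : a ∈ c.img V) :
    c.eval h (D (c.const h w)) a =
      ∑ j, c.eval h (D (O.res h (c.coord (Sum.inr j)))) a * Grassmann.contract j w := by
  induction w using Grassmann.left_induction with
  | algebraMap r =>
    have e : c.const h (algebraMap ℝ _ r) = algebraMap ℝ _ r :=
      c.eval_ext h fun y hy => by rw [c.eval_const h _ hy, c.eval_algebraMap h _ hy]
    rw [e, hD.map_algebraMap]
    simp [Grassmann.contract_algebraMap]
  | add x y hx hy =>
    have e : c.const h (x + y) = c.const h x + c.const h y :=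
      c.eval_ext h fun y hy => by
        rw [map_add, Pi.add_apply, c.eval_const h _ hy, c.eval_const h _ hy, c.eval_const h _ hy]
    rw [e, map_add, map_add, Pi.add_apply, hx, hy, ← Finset.sum_add_distrib]
    simp only [map_add, mul_add]
  | ι_mul v x hx =>
    have e : c.const h (ExteriorAlgebra.ι ℝ v * x) =
        ∑ j, v j • (O.res h (c.coord (Sum.inr j)) * c.const h x) :=
      c.eval_ext h fun y hy => by
        rw [map_sum, Finset.sum_apply, c.eval_const h _ hy, Grassmann.ι_eq_sum, Finset.sum_mul]
        refine Finset.sum_congr rfl fun j _ => ?_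
        rw [map_smul, Pi.smul_apply, eval_mul, Pi.mul_apply, c.eval_coord_inr h j hy,
          c.eval_const h _ hy, smul_mul_assoc]
    have one : ∀ j, c.eval h (D (O.res h (c.coord (Sum.inr j)) * c.const h x)) a =
        ∑ k, c.eval h (D (O.res h (c.coord (Sum.inr k)))) a *
          Grassmann.contract k (Grassmann.θ j * x) := by
      intro j
      -- moving `θ_j` past `D θ_k`
      have sw : ∀ k, Grassmann.θ j * c.eval h (D (O.res h (c.coord (Sum.inr k)))) a =
          ((-1 : ℤˣ) ^ (1 + δ)) • (c.eval h (D (O.res h (c.coord (Sum.inr k)))) a *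
            Grassmann.θ j) := by
        intro k
        have hk := hD.mem (c.coord_mem h (Sum.inr k))
        have := congrArg (fun F => c.eval h F a) (O.supercomm (c.coord_mem h (Sum.inr j)) hk)
        simp only [parity, Sum.elim_inr, one_mul] at this
        rw [eval_mul, Pi.mul_apply, c.eval_coord_inr h j ha] at this
        rw [this]
        rcases Int.units_eq_one_or ((-1 : ℤˣ) ^ (1 + δ)) with s | s <;>
          simp [s, eval_mul, c.eval_coord_inr h j ha]
      have hl := hD.leibniz (c.coord_mem h (Sum.inr j)) (c.const h x)
      simp only [parity, Sum.elim_inr, mul_one] at hl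
      have hl2 : c.eval h (D (O.res h (c.coord (Sum.inr j)) * c.const h x)) a =
          c.eval h (D (O.res h (c.coord (Sum.inr j)))) a * x + ((-1 : ℤˣ) ^ δ) •
            (Grassmann.θ j * c.eval h (D (c.const h x)) a) := by
        rw [hl]
        rcases Int.units_eq_one_or ((-1 : ℤˣ) ^ δ) with s | s <;>
          simp [s, eval_mul, c.eval_coord_inr h j ha, c.eval_const h x ha]
      rw [hl2, hx, Finset.mul_sum]
      simp only [← mul_assoc, sw, Grassmann.contract_θ_mul, mul_sub, Finset.sum_sub_distrib]
      rw [sub_eq_add_neg]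
      congr 1
      · simp
      · rw [uzpow_add, uzpow_one]
        rcases Int.units_eq_one_or ((-1 : ℤˣ) ^ δ) with s | s <;> simp [s, mul_assoc]
    rw [e, map_sum, map_sum, Finset.sum_apply]
    simp only [map_smul, Pi.smul_apply, one]
    simp only [Finset.smul_sum]
    rw [Finset.sum_comm]
    refine Finset.sum_congr rfl fun k _ => ?_
    rw [Grassmann.ι_eq_sum, Finset.sum_mul, map_sum, Finset.mul_sum]
    refine Finset.sum_congr rfl fun j _ => ?_
    rw [smul_mul_assoc, map_smul, mul_smul_comm]

/-- A derivation is the combination of the partial derivatives whose coefficients are its values on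
the coordinates. -/
theorem derivation_eq_sum (hD : IsGradedDerivation O V δ D) (h : V ≤ c.dom) (F : O.Sec V) :
    D F = ∑ a, D (O.res h (c.coord a)) * c.pderiv h a F := by
  refine c.eval_ext h fun y hy => ?_
  have hs : ∀ s, ContDiffOn ℝ ∞ (fun y => (Grassmann.basis q).coord s (c.eval h F y)) (c.img V) :=
    fun s => c.gSmoothOn_eval h F _
  have e : F = ∑ s, c.scalar h _ (hs s) * c.const h (Grassmann.basis q s) :=
    c.eval_ext h fun x hx => by
      rw [map_sum, Finset.sum_apply]
      conv_lhs => rw [← (Grassmann.basis q).sum_repr (c.eval h F x)]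
      refine Finset.sum_congr rfl fun s _ => ?_
      rw [eval_mul, Pi.mul_apply, c.eval_scalar h _ hx, c.eval_const h _ hx, Algebra.smul_def]
      rfl
  have l1 : c.eval h (D F) y = ∑ s, (∑ i, fderiv ℝ (fun y =>
      (Grassmann.basis q).coord s (c.eval h F y)) y (EuclideanSpace.single i 1) •
        c.eval h (D (O.res h (c.coord (Sum.inl i)))) y) * Grassmann.basis q s +
      ∑ s, (Grassmann.basis q).coord s (c.eval h F y) •
        ∑ j, c.eval h (D (O.res h (c.coord (Sum.inr j)))) y *
          Grassmann.contract j (Grassmann.basis q s) := by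
    conv_lhs => rw [e]
    rw [map_sum, map_sum, Finset.sum_apply, ← Finset.sum_add_distrib]
    refine Finset.sum_congr rfl fun s _ => ?_
    rw [hD.leibniz_even (c.scalar_mem h _), map_add, Pi.add_apply, eval_mul, eval_mul,
      Pi.mul_apply, Pi.mul_apply, c.eval_derivation_scalar hD h _ hy,
      c.eval_derivation_const hD h _ hy, c.eval_scalar h _ hy, c.eval_const h _ hy,
      ← Algebra.smul_def]
  rw [l1, map_sum, Finset.sum_apply, Fintype.sum_sum_type]
  congr 1
  · simp only [Finset.sum_mul]
    rw [Finset.sum_comm]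
    refine Finset.sum_congr rfl fun i _ => ?_
    rw [eval_mul, Pi.mul_apply, c.eval_pderiv_inl h i F hy, gderiv, Finset.mul_sum]
    refine Finset.sum_congr rfl fun s _ => ?_
    rw [smul_mul_assoc, mul_smul_comm]
  · simp only [Finset.smul_sum]
    rw [Finset.sum_comm]
    refine Finset.sum_congr rfl fun j _ => ?_
    rw [eval_mul, Pi.mul_apply, c.eval_pderiv_inr h j F hy]
    conv_rhs => rw [← (Grassmann.basis q).sum_repr (c.eval h F y), map_sum, Finset.mul_sum]
    refine Finset.sum_congr rfl fun s _ => ?_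
    rw [map_smul, mul_smul_comm]
    rfl

end SuperChart

/-! ### The Poincaré lemma -/

namespace SuperChart

variable {M : Type u} [TopologicalSpace M] {p q : ℕ} [ChartedSpace (EuclideanSpace ℝ (Fin p)) M]
  {O : SuperPresheaf.{u, v} M} (c : SuperChart p q O) {V : Opens M}

theorem pderiv_inr_coord_mul (h : V ≤ c.dom) (j k : Fin q) (F : O.Sec V) :
    c.pderiv h (Sum.inr j) (O.res h (c.coord (Sum.inr k)) * F) =
      (if j = k then F else 0) - O.res h (c.coord (Sum.inr k)) * c.pderiv h (Sum.inr j) F := by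
  refine c.eval_ext h fun y hy => ?_
  rw [c.eval_pderiv_inr h j _ hy, eval_mul, Pi.mul_apply, c.eval_coord_inr h k hy,
    Grassmann.contract_θ_mul, map_sub, Pi.sub_apply, eval_mul, Pi.mul_apply,
    c.eval_coord_inr h k hy, c.eval_pderiv_inr h j _ hy]
  congr 1
  split_ifs <;> simp

/-- A section whose derivatives in the odd directions vanish is a smooth function of the even
coordinates. -/
theorem eq_scalar_of_pderiv_inr_eq_zero (h : V ≤ c.dom) {F : O.Sec V}
    (hF : ∀ j, c.pderiv h (Sum.inr j) F = 0) :
    ∃ (f : EuclideanSpace ℝ (Fin p) → ℝ) (hf : ContDiffOn ℝ ∞ f (c.img V)),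
      F = c.scalar h f hf := by
  have hs : ContDiffOn ℝ ∞ (fun y => ExteriorAlgebra.algebraMapInv (c.eval h F y)) (c.img V) :=
    c.gSmoothOn_eval h F ExteriorAlgebra.algebraMapInv.toLinearMap
  refine ⟨_, hs, c.eval_ext h fun y hy => ?_⟩
  rw [c.eval_scalar h hs hy]
  refine Grassmann.eq_algebraMap_of_contract_eq_zero fun j => ?_
  rw [← c.eval_pderiv_inr h j F hy, hF, map_zero, Pi.zero_apply]

theorem eval_pderiv_inl_scalar (h : V ≤ c.dom) (i : Fin p) {f : EuclideanSpace ℝ (Fin p) → ℝ}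
    (hf : ContDiffOn ℝ ∞ f (c.img V)) {y : EuclideanSpace ℝ (Fin p)} (hy : y ∈ c.img V) :
    c.eval h (c.pderiv h (Sum.inl i) (c.scalar h f hf)) y =
      algebraMap ℝ _ (fderiv ℝ f y (EuclideanSpace.single i 1)) := by
  rw [c.eval_pderiv_inl h i _ hy,
    gderiv_congr (c.isOpen_img V) hy (fun x hx => c.eval_scalar h hf hx),
    gderiv_algebraMap hf (c.isOpen_img V) hy]

theorem pderiv_inr_scalar (h : V ≤ c.dom) (j : Fin q) {f : EuclideanSpace ℝ (Fin p) → ℝ}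
    (hf : ContDiffOn ℝ ∞ f (c.img V)) :
    c.pderiv h (Sum.inr j) (c.scalar h f hf) = 0 :=
  c.eval_ext h fun y hy => by
    rw [c.eval_pderiv_inr h j _ hy, c.eval_scalar h hf hy, Grassmann.contract_algebraMap, map_zero,
      Pi.zero_apply]

theorem algebraMap_injective : Function.Injective (algebraMap ℝ (Grassmann q)) :=
  FaithfulSMul.algebraMap_injective ℝ _

/-- If all partial derivatives of a section over a convex open set vanish, it is constant. -/
theorem eq_algebraMap_of_pderiv_eq_zero (h : V ≤ c.dom) (hV : Convex ℝ (c.img V)) {F : O.Sec V}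
    (hF : ∀ a, c.pderiv h a F = 0) : ∃ r : ℝ, F = algebraMap ℝ _ r := by
  obtain ⟨f, hf, rfl⟩ := c.eq_scalar_of_pderiv_inr_eq_zero h fun j => hF (Sum.inr j)
  have hd : ∀ y ∈ c.img V, fderiv ℝ f y = 0 := by
    intro y hy
    have hb : ∀ i, fderiv ℝ f y (EuclideanSpace.single i 1) = 0 := fun i =>
      algebraMap_injective (q := q) (by
        rw [← c.eval_pderiv_inl_scalar h i hf hy, hF, map_zero, Pi.zero_apply, map_zero])
    refine ContinuousLinearMap.coe_injective
      ((EuclideanSpace.basisFun (Fin p) ℝ).toBasis.ext fun i => ?_)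
    simpa using hb i
  rcases (c.img V).eq_empty_or_nonempty with h0 | ⟨a, ha⟩
  · exact ⟨0, c.eval_ext h fun y hy => by simp [h0] at hy⟩
  · refine ⟨f a, c.eval_ext h fun y hy => ?_⟩
    rw [c.eval_scalar h hf hy, c.eval_algebraMap h _ hy,
      (c.isOpen_img V).is_const_of_fderiv_eq_zero hV.isPreconnected
        (hf.differentiableOn (by simp)) hd hy ha]

/-- A closed `1`-form is exact in the odd directions. -/
theorem exists_primitive_odd (h : V ≤ c.dom) (w : Fin p ⊕ Fin q → O.Sec V)
    (hw : ∀ a b, c.pderiv h a (w b) =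
      ((-1 : ℤˣ) ^ (parity a * parity b)) • c.pderiv h b (w a)) (J : Finset (Fin q)) :
    ∃ H : O.Sec V, ∀ j ∈ J, c.pderiv h (Sum.inr j) H = w (Sum.inr j) := by
  induction J using Finset.induction_on with
  | empty => exact ⟨0, by simp⟩
  | insert k J hk ih =>
    obtain ⟨H, hH⟩ := ih
    -- the part of the form that is left after subtracting `dH`
    let w' : Fin q → O.Sec V := fun j => w (Sum.inr j) - c.pderiv h (Sum.inr j) H
    have hw' : ∀ i j, c.pderiv h (Sum.inr i) (w' j) = -c.pderiv h (Sum.inr j) (w' i) := by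
      intro i j
      have h1 := hw (Sum.inr i) (Sum.inr j)
      have h2 := c.pderiv_comm h (Sum.inr i) (Sum.inr j) H
      simp only [parity, Sum.elim_inr, mul_one, uzpow_one, Units.neg_smul, one_smul] at h1 h2
      simp only [w', map_sub, h1, h2]
      abel
    have hself : ∀ i, c.pderiv h (Sum.inr i) (w' i) = 0 := fun i => by
      have h1 := hw' i i
      have h2 : (2 : ℝ) • c.pderiv h (Sum.inr i) (w' i) = 0 := by
        rw [two_smul]
        nth_rewrite 1 [h1]
        exact neg_add_cancel _
      exact (smul_eq_zero.1 h2).resolve_left two_ne_zero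
    -- `w' k` does not depend on `θ_k`, so that `θ_k * w' k` is a primitive of it
    refine ⟨H + O.res h (c.coord (Sum.inr k)) * w' k, fun j hj => ?_⟩
    rw [map_add, c.pderiv_inr_coord_mul]
    by_cases hjk : j = k
    · subst hjk
      rw [hself]
      simp [w']
    · have hjJ : j ∈ J := (Finset.mem_insert.1 hj).resolve_left hjk
      have : w' j = 0 := by simp only [w', hH j hjJ, sub_self]
      rw [hw' j k, this, map_zero, hH j hjJ]
      simp [hjk]

/-- The **Poincaré lemma**: a closed `1`-form over a convex open set is exact. -/
theorem exists_primitive (h : V ≤ c.dom) (hV : Convex ℝ (c.img V)) (w : Fin p ⊕ Fin q → O.Sec V)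
    (hw : ∀ a b, c.pderiv h a (w b) =
      ((-1 : ℤˣ) ^ (parity a * parity b)) • c.pderiv h b (w a)) :
    ∃ H : O.Sec V, ∀ a, c.pderiv h a H = w a := by
  obtain ⟨H, hH⟩ := c.exists_primitive_odd h w hw Finset.univ
  -- subtracting `dH` leaves an ordinary closed form on an open subset of `ℝ^p`
  let w' : Fin p → O.Sec V := fun i => w (Sum.inl i) - c.pderiv h (Sum.inl i) H
  have hodd : ∀ i j, c.pderiv h (Sum.inr j) (w' i) = 0 := by
    intro i j
    have h1 := hw (Sum.inr j) (Sum.inl i)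
    have h2 := c.pderiv_comm h (Sum.inr j) (Sum.inl i) H
    simp only [parity, Sum.elim_inl, mul_zero, uzpow_zero, one_smul] at h1 h2
    simp only [w', map_sub, h1, h2, hH j (Finset.mem_univ j), sub_self]
  have heven : ∀ i k, c.pderiv h (Sum.inl i) (w' k) = c.pderiv h (Sum.inl k) (w' i) := by
    intro i k
    have h1 := hw (Sum.inl i) (Sum.inl k)
    have h2 := c.pderiv_comm h (Sum.inl i) (Sum.inl k) H
    simp only [parity, Sum.elim_inl, mul_zero, uzpow_zero, one_smul] at h1 h2
    simp only [w', map_sub, h1, h2]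
  choose f hf hfw using fun i => c.eq_scalar_of_pderiv_inr_eq_zero h (hodd i)
  let α : EuclideanSpace ℝ (Fin p) → EuclideanSpace ℝ (Fin p) →L[ℝ] ℝ := fun y =>
    ∑ i, f i y • EuclideanSpace.proj i
  have hα : ContDiffOn ℝ ∞ α (c.img V) :=
    ContDiffOn.sum fun i _ => (hf i).smul contDiffOn_const
  have hfd : ∀ i, ∀ y ∈ c.img V, DifferentiableAt ℝ (f i) y := fun i y hy =>
    ((hf i).contDiffAt ((c.isOpen_img V).mem_nhds hy)).differentiableAt (by simp)
  have hsymm : ∀ y ∈ c.img V, ∀ i k, fderiv ℝ (f k) y (EuclideanSpace.single i 1) =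
      fderiv ℝ (f i) y (EuclideanSpace.single k 1) := by
    intro y hy i k
    refine algebraMap_injective (q := q) ?_
    rw [← c.eval_pderiv_inl_scalar h i (hf k) hy, ← c.eval_pderiv_inl_scalar h k (hf i) hy,
      ← hfw, ← hfw, heven]
  have hdα : ∀ y ∈ c.img V, ∀ u v, fderiv ℝ α y u v =
      ∑ i, ∑ k, u k * v i * fderiv ℝ (f i) y (EuclideanSpace.single k 1) := by
    intro y hy u v
    have hsum : u = ∑ k, u k • EuclideanSpace.single k (1 : ℝ) := by
      ext j
      simp [Finset.sum_apply, Pi.single_apply]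
    have hα' : HasFDerivAt α (∑ i, (fderiv ℝ (f i) y).smulRight
        (EuclideanSpace.proj i : EuclideanSpace ℝ (Fin p) →L[ℝ] ℝ)) y :=
      HasFDerivAt.fun_sum fun i _ => (hfd i y hy).hasFDerivAt.smul_const
        (EuclideanSpace.proj i : EuclideanSpace ℝ (Fin p) →L[ℝ] ℝ)
    rw [hα'.fderiv, sum_apply, sum_apply]
    refine Finset.sum_congr rfl fun i _ => ?_
    rw [ContinuousLinearMap.smulRight_apply]
    conv_lhs => rw [hsum, map_sum]
    simp only [map_smul, smul_apply, smul_eq_mul, Finset.sum_mul]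
    refine Finset.sum_congr rfl fun k _ => ?_
    rw [show (EuclideanSpace.proj i : EuclideanSpace ℝ (Fin p) →L[ℝ] ℝ) v = v i from rfl]
    ring
  obtain ⟨φ, hφ⟩ := hV.exists_forall_hasFDerivAt_of_fderiv_symmetric (c.isOpen_img V)
    (hα.differentiableOn (by simp)) (by
      intro y hy u v
      rw [hdα y hy, hdα y hy, Finset.sum_comm]
      refine Finset.sum_congr rfl fun i _ => Finset.sum_congr rfl fun k _ => ?_
      rw [hsymm y hy, mul_comm (u i)])
  have hφs : ContDiffOn ℝ ∞ φ (c.img V) := by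
    rw [contDiffOn_infty_iff_fderiv_of_isOpen (c.isOpen_img V)]
    exact ⟨fun y hy => (hφ y hy).differentiableAt.differentiableWithinAt,
      hα.congr fun y hy => (hφ y hy).fderiv⟩
  refine ⟨H + c.scalar h φ hφs, ?_⟩
  rintro (i | j)
  · rw [map_add, ← eq_sub_iff_add_eq']
    refine Eq.trans ?_ (hfw i).symm
    refine c.eval_ext h fun y hy => ?_
    rw [c.eval_pderiv_inl_scalar h i hφs hy, c.eval_scalar h _ hy, (hφ y hy).fderiv]
    simp [α]
  · rw [map_add, c.pderiv_inr_scalar, add_zero, hH j (Finset.mem_univ j)]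

end SuperChart

/-! ### Vector fields preserving the antibracket -/

theorem map_sign_smul {A B : Type*} [AddCommGroup A] [Module ℝ A] [AddCommGroup B] [Module ℝ B]
    (f : A →ₗ[ℝ] B) (s : ℤˣ) (x : A) : f (s • x) = s • f x := by
  rcases Int.units_eq_one_or s with rfl | rfl <;> simp

theorem sign_smul_mem {A : Type*} [AddCommGroup A] [Module ℝ A] (S : Submodule ℝ A) (s : ℤˣ) {x : A}
    (hx : x ∈ S) : s • x ∈ S := by
  rcases Int.units_eq_one_or s with rfl | rfl <;> simpa using hx

section Homogeneous

variable {M : Type u} [TopologicalSpace M] (O : SuperPresheaf.{u, v} M) {V : Opens M}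

theorem SuperPresheaf.exists_part (F : O.Sec V) (i : ZMod 2) :
    ∃ F₀ ∈ O.part V i, ∃ F₁ ∈ O.part V (i + 1), F = F₀ + F₁ := by
  obtain ⟨A, hA, B, hB, rfl⟩ := O.exists_parts F
  rcases parity_cases i with rfl | rfl
  · exact ⟨A, hA, B, hB, rfl⟩
  · exact ⟨B, hB, A, hA, add_comm _ _⟩

theorem SuperPresheaf.eq_of_add_eq {i : ZMod 2} {F F₀ F₁ : O.Sec V} (hF : F ∈ O.part V i)
    (h₀ : F₀ ∈ O.part V i) (h₁ : F₁ ∈ O.part V (i + 1)) (e : F₀ + F₁ = F) : F₀ = F := by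
  rcases parity_cases i with rfl | rfl
  · exact (O.parts_unique h₀ h₁ hF (Submodule.zero_mem _) (by rw [e, add_zero])).1
  · exact (O.parts_unique h₁ h₀ (Submodule.zero_mem _) hF (by rw [zero_add, add_comm, e])).2

/-- The sign for reversing the order of three homogeneous factors. -/
theorem SuperPresheaf.mul_mul_swap {i j k : ZMod 2} {x y z : O.Sec V} (hx : x ∈ O.part V i)
    (hy : y ∈ O.part V j) (hz : z ∈ O.part V k) :
    x * y * z = ((-1 : ℤˣ) ^ (i * j + i * k + j * k)) • (z * y * x) := by
  rw [O.supercomm hx hy, smul_mul_assoc, mul_assoc, O.supercomm hx hz, mul_smul_comm, ← mul_assoc,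
    O.supercomm hy hz, smul_mul_assoc, smul_smul, smul_smul, ← uzpow_add, ← uzpow_add]

theorem Antibracket.isGradedDerivation (B : Antibracket O) {i : ZMod 2} {F : O.Sec V}
    (hF : F ∈ O.part V i) : IsGradedDerivation O V (i + 1) (B.br V F) where
  mem {j} {G} hG := by
    have := B.br_mem hF hG
    rwa [show i + j + 1 = j + (i + 1) by ring] at this
  leibniz {j} {G} hG H := by
    rw [B.leibniz hF hG, mul_comm j]

theorem VectorField.isGradedDerivation {ε : ZMod 2} (X : VectorField O ε) (V : Opens M) :
    IsGradedDerivation O V ε (X.app V) where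
  mem := X.app_mem
  leibniz := X.leibniz

end Homogeneous

namespace SuperChart

variable {M : Type u} [TopologicalSpace M] {N : ℕ} [ChartedSpace (EuclideanSpace ℝ (Fin N)) M]
  {O : SuperPresheaf.{u, v} M} (c : SuperChart N N O) {V : Opens M} (h : V ≤ c.dom)
  (B : Antibracket O)

/-- The coordinates, restricted to an open set. -/
noncomputable def rcoord (a : Fin N ⊕ Fin N) : O.Sec V := O.res h (c.coord a)

/-- The matrix of the antibracket in the coordinates of a superchart. -/
noncomputable def bracketMatrix : Matrix (Fin N ⊕ Fin N) (Fin N ⊕ Fin N) (O.Sec V) :=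
  Matrix.of fun a b => B.br V (c.rcoord h a) (c.rcoord h b)

theorem rcoord_mem (a : Fin N ⊕ Fin N) : c.rcoord h a ∈ O.part V (parity a) := c.coord_mem h a

theorem isUnit_bracketMatrix (hB : B.Nondegenerate N) : IsUnit (c.bracketMatrix h B) := by
  have := (hB c).map (O.res h).toRingHom.mapMatrix
  convert this using 1
  ext a b
  exact B.br_res h _ _

theorem bracketMatrix_mem (a b : Fin N ⊕ Fin N) :
    c.bracketMatrix h B a b ∈ O.part V (parity a + parity b + 1) :=
  B.br_mem (c.rcoord_mem h a) (c.rcoord_mem h b)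

theorem bracketMatrix_swap (a b : Fin N ⊕ Fin N) :
    c.bracketMatrix h B a b =
      -(((-1 : ℤˣ) ^ ((parity a + 1) * (parity b + 1))) • c.bracketMatrix h B b a) :=
  B.antisymm (c.rcoord_mem h a) (c.rcoord_mem h b)

theorem br_rcoord_eq_sum (b : Fin N ⊕ Fin N) (F : O.Sec V) :
    B.br V (c.rcoord h b) F = ∑ a, c.bracketMatrix h B b a * c.pderiv h a F :=
  c.derivation_eq_sum (B.isGradedDerivation O (c.rcoord_mem h b)) h F

variable {B}

/-- If the antibracket is nondegenerate, every vector field is a combination of the Hamiltonian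
vector fields of the coordinates. -/
theorem exists_components (hB : B.Nondegenerate N) {ε : ZMod 2} (X : VectorField O ε) :
    ∃ w : Fin N ⊕ Fin N → O.Sec V, (∀ a, w a ∈ O.part V (ε + 1 + parity a)) ∧
      ∀ F, X.app V F = ∑ a, w a * B.br V (c.rcoord h a) F := by
  obtain ⟨m, hm⟩ := c.isUnit_bracketMatrix h B hB
  let ξ : Fin N ⊕ Fin N → O.Sec V := fun b => X.app V (c.rcoord h b)
  let t := Matrix.vecMul ξ (↑m⁻¹ : Matrix (Fin N ⊕ Fin N) (Fin N ⊕ Fin N) (O.Sec V))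
  have ht : Matrix.vecMul t (c.bracketMatrix h B) = ξ := by
    rw [Matrix.vecMul_vecMul, ← hm, Units.inv_mul, Matrix.vecMul_one]
  -- the entries of the inverse matrix need not be known to be homogeneous: it suffices to keep the
  -- part of the right parity
  choose w hw w' hw' hww' using fun a => O.exists_part (t a) (ε + 1 + parity a)
  have key : ∀ b, ∑ a, w a * c.bracketMatrix h B a b = X.app V (c.rcoord h b) := by
    intro b
    refine O.eq_of_add_eq (F₁ := ∑ a, w' a * c.bracketMatrix h B a b)
      (X.app_mem (c.rcoord_mem h b)) (Submodule.sum_mem _ fun a _ => ?_)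
      (Submodule.sum_mem _ fun a _ => ?_) ?_
    · have := O.mul_mem (hw a) (c.bracketMatrix_mem h B a b)
      rwa [(by decide : ∀ ε a b : ZMod 2, ε + 1 + a + (a + b + 1) = b + ε)] at this
    · have := O.mul_mem (hw' a) (c.bracketMatrix_mem h B a b)
      rwa [(by decide : ∀ ε a b : ZMod 2, ε + 1 + a + 1 + (a + b + 1) = b + ε + 1)] at this
    · rw [← Finset.sum_add_distrib]
      refine Eq.trans ?_ (congrFun ht b)
      simp only [← add_mul, ← hww']
      rfl
  refine ⟨w, hw, fun F => ?_⟩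
  rw [c.derivation_eq_sum (X.isGradedDerivation O V) h F]
  simp only [br_rcoord_eq_sum, Finset.mul_sum]
  rw [Finset.sum_comm]
  refine Finset.sum_congr rfl fun e _ => ?_
  rw [← rcoord, ← key, Finset.sum_mul]
  simp only [mul_assoc]

/-- The Jacobi identity for three coordinates, solved for one of its terms. -/
theorem jacobi_rcoord (a b e : Fin N ⊕ Fin N) :
    B.br V (c.rcoord h a) (c.bracketMatrix h B b e) =
      ((-1 : ℤˣ) ^ ((parity b + 1) * (parity a + 1))) •
        B.br V (c.rcoord h b) (c.bracketMatrix h B a e) -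
      ((-1 : ℤˣ) ^ ((parity e + 1) * (parity b + parity a))) •
        B.br V (c.rcoord h e) (c.bracketMatrix h B a b) := by
  have J := B.jacobi (c.rcoord_mem h a) (c.rcoord_mem h b) (c.rcoord_mem h e)
  change _ • B.br V _ (c.bracketMatrix h B b e) + _ • B.br V _ (c.bracketMatrix h B e a) +
    _ • B.br V _ (c.bracketMatrix h B a b) = 0 at J
  rw [c.bracketMatrix_swap h B e a, map_neg, map_sign_smul, smul_neg, smul_smul, ← uzpow_add] at J
  have J' := congrArg (fun F => ((-1 : ℤˣ) ^ ((parity a + 1) * (parity e + 1))) • F) J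
  simp only [smul_add, smul_neg, smul_smul, ← uzpow_add, smul_zero] at J'
  rw [(by decide : ∀ a e : ZMod 2, (a + 1) * (e + 1) + (a + 1) * (e + 1) = 0),
    (by decide : ∀ a b e : ZMod 2, (a + 1) * (e + 1) + ((b + 1) * (a + 1) + (e + 1) * (a + 1)) =
      (b + 1) * (a + 1)),
    (by decide : ∀ a b e : ZMod 2, (a + 1) * (e + 1) + (e + 1) * (b + 1) = (e + 1) * (b + a)),
    uzpow_zero, one_smul] at J'
  rw [← sub_eq_zero, ← J']
  abel

/-- Preservation of the antibracket of two coordinates by `∑ w_a (Γ^a, ·)`. The terms in which `w_a`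
is not differentiated cancel by the Jacobi identity. -/
theorem sum_br_component_eq {ε : ZMod 2} {X : VectorField O ε} (hX : B.PreservedBy X)
    {w : Fin N ⊕ Fin N → O.Sec V} (hw : ∀ a, w a ∈ O.part V (ε + 1 + parity a))
    (hXw : ∀ F, X.app V F = ∑ a, w a * B.br V (c.rcoord h a) F) (b e : Fin N ⊕ Fin N) :
    ∑ a, ((-1 : ℤˣ) ^ ((parity b + (ε + 1)) * (parity e + 1))) •
        (B.br V (c.rcoord h e) (w a) * c.bracketMatrix h B a b) =
      ∑ a, ((-1 : ℤˣ) ^ ((parity b + 1) * ε)) •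
        (B.br V (c.rcoord h b) (w a) * c.bracketMatrix h B a e) := by
  have expand : ∀ b e, B.br V (c.rcoord h b) (X.app V (c.rcoord h e)) =
      ∑ a, (B.br V (c.rcoord h b) (w a) * c.bracketMatrix h B a e +
        ((-1 : ℤˣ) ^ ((ε + 1 + parity a) * (parity b + 1))) •
          (w a * B.br V (c.rcoord h b) (c.bracketMatrix h B a e))) := by
    intro b e
    rw [hXw, map_sum]
    exact Finset.sum_congr rfl fun a _ => B.leibniz (c.rcoord_mem h b) (hw a) _
  have h1 := hX V (parity b) (c.rcoord h b) (c.rcoord h e) (c.rcoord_mem h b)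
  rw [B.antisymm (X.app_mem (c.rcoord_mem h b)) (c.rcoord_mem h e), expand, expand, hXw,
    Finset.smul_sum, Finset.smul_sum, sub_neg_eq_add, ← Finset.sum_add_distrib,
    ← Finset.sum_sub_distrib] at h1
  rw [← sub_eq_zero, ← Finset.sum_sub_distrib, ← h1]
  refine Finset.sum_congr rfl fun a _ => ?_
  change _ = w a * B.br V (c.rcoord h a) (c.bracketMatrix h B b e) + _ - _
  rw [c.jacobi_rcoord h a b e, mul_sub, mul_smul_comm, mul_smul_comm, smul_add, smul_add, smul_smul,
    smul_smul, ← uzpow_add, ← uzpow_add,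
    (by decide : ∀ ε a b e : ZMod 2, (b + ε + 1) * (e + 1) + (ε + 1 + a) * (e + 1) =
      (e + 1) * (b + a)),
    (by decide : ∀ ε a b : ZMod 2, (b + 1) * ε + (ε + 1 + a) * (b + 1) = (b + 1) * (a + 1)),
    add_assoc]
  abel

/-- The components of a vector field that preserves the antibracket form, up to signs, a closed
`1`-form. -/
theorem pderiv_component_comm (hB : B.Nondegenerate N) {ε : ZMod 2} {X : VectorField O ε}
    (hX : B.PreservedBy X)
    {w : Fin N ⊕ Fin N → O.Sec V} (hw : ∀ a, w a ∈ O.part V (ε + 1 + parity a))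
    (hXw : ∀ F, X.app V F = ∑ a, w a * B.br V (c.rcoord h a) F) (d a : Fin N ⊕ Fin N) :
    c.pderiv h d (w a) = ((-1 : ℤˣ) ^ ((parity a + parity d) * ε + parity a * parity d)) •
      c.pderiv h a (w d) := by
  let K : Matrix (Fin N ⊕ Fin N) (Fin N ⊕ Fin N) (O.Sec V) := Matrix.of fun d a =>
    c.pderiv h d (w a) - ((-1 : ℤˣ) ^ ((parity a + parity d) * ε + parity a * parity d)) •
      c.pderiv h a (w d)
  have hK : c.bracketMatrix h B * K * c.bracketMatrix h B = 0 := by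
    refine Matrix.ext fun e b => ?_
    have h1 := c.sum_br_component_eq h hX hw hXw b e
    simp only [br_rcoord_eq_sum, Finset.sum_mul, Finset.smul_sum] at h1
    -- reversing the order of the three factors on the right
    have swap : ∀ a d, c.bracketMatrix h B b d * c.pderiv h d (w a) * c.bracketMatrix h B a e =
        ((-1 : ℤˣ) ^ ((parity b + 1) * (parity d + 1) + (parity a + 1) * (parity e + 1) +
          ((parity d + parity b + 1) * (ε + 1 + parity a + parity d) +
          (parity d + parity b + 1) * (parity e + parity a + 1) +
          (ε + 1 + parity a + parity d) * (parity e + parity a + 1)))) •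
        (c.bracketMatrix h B e a * c.pderiv h d (w a) * c.bracketMatrix h B d b) := by
      intro a d
      rw [c.bracketMatrix_swap h B b d, c.bracketMatrix_swap h B a e, neg_mul, neg_mul, mul_neg,
        neg_neg, smul_mul_assoc, smul_mul_assoc, mul_smul_comm,
        O.mul_mul_swap (c.bracketMatrix_mem h B d b) (c.pderiv_mem h d (hw a))
          (c.bracketMatrix_mem h B e a), smul_smul, smul_smul, ← uzpow_add, ← uzpow_add, add_assoc]
    simp only [swap, smul_smul, ← uzpow_add] at h1
    rw [Finset.sum_comm (f := fun a d => ((-1 : ℤˣ) ^ ((parity b + 1) * ε + _)) • _)] at h1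
    have h2 := congrArg (fun F => ((-1 : ℤˣ) ^ ((parity b + (ε + 1)) * (parity e + 1))) • F) h1
    simp only [Finset.smul_sum, smul_smul, ← uzpow_add] at h2
    rw [← sub_eq_zero, ← Finset.sum_sub_distrib] at h2
    simp only [← Finset.sum_sub_distrib] at h2
    rw [Matrix.mul_apply]
    simp only [Matrix.mul_apply, Finset.sum_mul, Matrix.zero_apply]
    rw [← h2]
    refine Finset.sum_congr rfl fun a _ => Finset.sum_congr rfl fun d _ => ?_
    simp only [K, Matrix.of_apply]
    rw [mul_sub, sub_mul, mul_smul_comm, smul_mul_assoc,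
      (by decide : ∀ ε b e : ZMod 2,
        (b + (ε + 1)) * (e + 1) + (b + (ε + 1)) * (e + 1) = 0), uzpow_zero, one_smul]
    congr 3
    exact (by decide : ∀ ε a b d e : ZMod 2, (a + d) * ε + a * d =
      (b + (ε + 1)) * (e + 1) + ((b + 1) * ε + ((b + 1) * (a + 1) + (d + 1) * (e + 1) +
        ((a + b + 1) * (ε + 1 + d + a) + (a + b + 1) * (e + d + 1) +
          (ε + 1 + d + a) * (e + d + 1))))) ε (parity a) (parity b) (parity d) (parity e)
  obtain ⟨m, hm⟩ := c.isUnit_bracketMatrix h B hB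
  rw [← hm, mul_assoc, Units.mul_right_eq_zero, Units.mul_left_eq_zero] at hK
  exact sub_eq_zero.1 (congrFun (congrFun hK d) a)

end SuperChart

namespace SuperChart

variable {M : Type u} [TopologicalSpace M] {N : ℕ} [ChartedSpace (EuclideanSpace ℝ (Fin N)) M]
  {O : SuperPresheaf.{u, v} M} (c : SuperChart N N O) {V : Opens M}
  {B : Antibracket O}

/-- A vector field that preserves a nondegenerate antibracket is Hamiltonian over every convex
open set of a superchart. -/
theorem exists_hamiltonian (h : V ≤ c.dom) (hB : B.Nondegenerate N)
    (hV : Convex ℝ (c.img V)) {ε : ZMod 2} {X : VectorField O ε} (hX : B.PreservedBy X) :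
    ∃ H ∈ O.part V (ε + 1), ∀ (U : Opens M) (k : U ≤ V) (F : O.Sec U),
      X.app U F = B.br U (O.res k H) F := by
  obtain ⟨w, hw, hXw⟩ := c.exists_components h hB X
  -- the components `w` are right derivatives; the signs turn them into left derivatives
  obtain ⟨H', hH'⟩ := c.exists_primitive h hV
    (fun a => ((-1 : ℤˣ) ^ (parity a * ε)) • w a) (by
      intro a b
      simp only [map_sign_smul]
      rw [c.pderiv_component_comm h hB hX hw hXw a b, smul_smul, smul_smul, ← uzpow_add,
        ← uzpow_add, (by decide : ∀ ε a b : ZMod 2, b * ε + ((b + a) * ε + b * a) =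
          a * b + a * ε)])
  obtain ⟨H, hH, H₁, hH₁, rfl⟩ := O.exists_part H' (ε + 1)
  have hd : ∀ a, c.pderiv h a H = ((-1 : ℤˣ) ^ (parity a * ε)) • w a := by
    intro a
    refine O.eq_of_add_eq (sign_smul_mem _ _ (hw a)) (c.pderiv_mem h a hH) ?_
      (by rw [← map_add, hH'])
    have := c.pderiv_mem h a hH₁
    rwa [add_right_comm] at this
  -- `(H, ·)` and `X` agree on the coordinates, hence everywhere
  have hc : ∀ b, B.br V H (c.rcoord h b) = X.app V (c.rcoord h b) := by
    intro b
    rw [B.antisymm hH (c.rcoord_mem h b), c.br_rcoord_eq_sum, hXw, Finset.smul_sum,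
      ← Finset.sum_neg_distrib]
    refine Finset.sum_congr rfl fun a _ => ?_
    change _ = w a * c.bracketMatrix h B a b
    rw [hd, mul_smul_comm, O.supercomm (c.bracketMatrix_mem h B b a) (hw a),
      c.bracketMatrix_swap h B b a, mul_neg, mul_smul_comm, smul_neg, smul_neg, smul_neg, neg_neg,
      smul_smul, smul_smul, smul_smul, ← uzpow_add, ← uzpow_add, ← uzpow_add,
      (by decide : ∀ ε a b : ZMod 2, (ε + 1 + 1) * (b + 1) + a * ε + (b + a + 1) * (ε + 1 + a) +
        (b + 1) * (a + 1) = 0), uzpow_zero, one_smul]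
  refine ⟨H, hH, fun U k F => ?_⟩
  rw [c.derivation_eq_sum (X.isGradedDerivation O U) (k.trans h) F,
    c.derivation_eq_sum (B.isGradedDerivation O (O.res_mem k hH)) (k.trans h) F]
  refine Finset.sum_congr rfl fun a _ => ?_
  rw [← O.res_res k h, X.app_res, B.br_res]
  exact congrArg (fun G => O.res k G * _) (hc a).symm

/-- The centre of a nondegenerate antibracket over a convex open set consists of the constants. -/
theorem eq_algebraMap_of_br_eq_zero (h : V ≤ c.dom) (hB : B.Nondegenerate N)
    (hV : Convex ℝ (c.img V)) {F : O.Sec V} (hF : ∀ b, B.br V (c.rcoord h b) F = 0) :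
    ∃ r : ℝ, F = algebraMap ℝ _ r := by
  obtain ⟨m, hm⟩ := c.isUnit_bracketMatrix h B hB
  have h0 : Matrix.mulVec (c.bracketMatrix h B) (fun a => c.pderiv h a F) = 0 := by
    funext b
    exact (c.br_rcoord_eq_sum h B b F).symm.trans (hF b)
  refine c.eq_algebraMap_of_pderiv_eq_zero h hV fun a => ?_
  have h1 := congrArg (Matrix.mulVec
    (↑m⁻¹ : Matrix (Fin N ⊕ Fin N) (Fin N ⊕ Fin N) (O.Sec V))) h0
  rw [Matrix.mulVec_mulVec, ← hm, Units.inv_mul, Matrix.one_mulVec, Matrix.mulVec_zero] at h1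
  exact congrFun h1 a

/-- Every point of a superchart has a convex open neighbourhood. -/
theorem exists_convex_nhd {z : M} (hz : z ∈ c.dom) :
    ∃ V : Opens M, ∃ _ : V ≤ c.dom, z ∈ V ∧ Convex ℝ (c.img V) := by
  obtain ⟨r, hr, hrW⟩ := Metric.isOpen_iff.1 (c.isOpen_img c.dom) _ (c.chart_mem_img le_rfl hz)
  refine ⟨⟨c.chart.source ∩ c.chart ⁻¹' Metric.ball (c.chart z) r,
    c.chart.isOpen_inter_preimage Metric.isOpen_ball⟩, ?_, ?_, ?_⟩
  · rintro x ⟨hx, hxr⟩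
    have := (hrW hxr).2
    rwa [Set.mem_preimage, c.chart.left_inv hx] at this
  · exact ⟨c.dom_subset hz, Metric.mem_ball_self hr⟩
  · have e : c.img ⟨c.chart.source ∩ c.chart ⁻¹' Metric.ball (c.chart z) r,
        c.chart.isOpen_inter_preimage Metric.isOpen_ball⟩ = Metric.ball (c.chart z) r := by
      ext y
      constructor
      · rintro ⟨hy, -, hy2⟩
        rwa [Set.mem_preimage, c.chart.right_inv hy] at hy2
      · intro hy
        have hyt := (hrW hy).1
        exact ⟨hyt, c.chart.map_target hyt, by
          rw [Set.mem_preimage, c.chart.right_inv hyt]; exact hy⟩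
    rw [e]
    exact convex_ball _ _

end SuperChart

/-! ### Symmetries of QP-manifolds -/

namespace QPStructure

variable {M : Type u} [TopologicalSpace M] {N : ℕ} [ChartedSpace (EuclideanSpace ℝ (Fin N)) M]
  {O : SuperPresheaf.{u, v} M} {S : QPStructure N O} {ε : ZMod 2} {X : VectorField O ε}

theorem IsSymmetry.app_Q (hX : S.IsSymmetry X) {U : Opens M} (F : O.Sec U) :
    X.app U (S.Q.app U F) = ((-1 : ℤˣ) ^ ε) • S.Q.app U (X.app U F) := by
  have := sub_eq_zero.1 (hX.commutes U F)
  rw [one_mul] at this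
  rw [this, smul_smul, ← uzpow_add, CharTwo.add_self_eq_zero, uzpow_zero, one_smul]

theorem IsSymmetry.app_mem_zeroIdeal (hX : S.IsSymmetry X) {U : Opens M} {F : O.Sec U}
    (hF : F ∈ S.Q.zeroIdeal U) : X.app U F ∈ S.Q.zeroIdeal U := by
  have exact_mem : ∀ (V : Opens M) (F : O.Sec V), F ∈ S.Q.exactIdeal V →
      X.app V F ∈ S.Q.exactIdeal V := by
    intro V F hF
    refine Submodule.span_induction (p := fun F _ => X.app V F ∈ S.Q.exactIdeal V) ?_ ?_ ?_ ?_
      hF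
    · rintro _ ⟨G, rfl⟩
      rw [hX.app_Q]
      exact O.units_smul_mem _ _ (Ideal.subset_span ⟨_, rfl⟩)
    · rw [map_zero]
      exact Ideal.zero_mem _
    · intro F G _ _ h h'
      rw [map_add]
      exact Ideal.add_mem _ h h'
    · intro A F hF h
      obtain ⟨A₀, h₀, A₁, h₁, rfl⟩ := O.exists_parts A
      rw [smul_eq_mul, add_mul, map_add, X.leibniz h₀, X.leibniz h₁]
      exact Ideal.add_mem _
        (Ideal.add_mem _ (Ideal.mul_mem_left _ _ hF)
          (O.units_smul_mem _ _ (Ideal.mul_mem_left _ _ h)))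
        (Ideal.add_mem _ (Ideal.mul_mem_left _ _ hF)
          (O.units_smul_mem _ _ (Ideal.mul_mem_left _ _ h)))
  intro x hx
  obtain ⟨V, h, hxV, hV⟩ := hF x hx
  exact ⟨V, h, hxV, by rw [← X.app_res]; exact exact_mem V _ hV⟩

theorem toZeroLocus_surjective (Q : VectorField O 1) (U : Opens M) :
    Function.Surjective (Q.toZeroLocus U) :=
  Ideal.Quotient.mkₐ_surjective ℝ _

theorem toZeroLocus_sign_smul (Q : VectorField O 1) (U : Opens M) (s : ℤˣ) (F : O.Sec U) :
    Q.toZeroLocus U (s • F) = s • Q.toZeroLocus U F :=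
  map_sign_smul (Q.toZeroLocus U).toLinearMap s F

/-- The restriction of a symmetry to the zero locus. -/
noncomputable def IsSymmetry.restrict (hX : S.IsSymmetry X) : VectorField S.Q.zeroLocus ε where
  app U := Submodule.mapQ ((S.Q.zeroIdeal U).restrictScalars ℝ)
    ((S.Q.zeroIdeal U).restrictScalars ℝ) (X.app U) fun _ hF => hX.app_mem_zeroIdeal hF
  app_mem := by
    rintro U i _ ⟨F, hF, rfl⟩
    exact ⟨X.app U F, X.app_mem hF, rfl⟩
  leibniz := by
    rintro U i _ ⟨F, hF, rfl⟩ G'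
    obtain ⟨G, rfl⟩ := toZeroLocus_surjective S.Q U G'
    have := congrArg (S.Q.toZeroLocus U) (X.leibniz hF G)
    rw [map_add, toZeroLocus_sign_smul, map_mul (S.Q.toZeroLocus U) (X.app U F) G,
      map_mul (S.Q.toZeroLocus U) F (X.app U G)] at this
    exact this
  app_res := by
    intro U V h F'
    obtain ⟨F, rfl⟩ := toZeroLocus_surjective S.Q V F'
    exact congrArg (S.Q.toZeroLocus U) (X.app_res h F)

theorem IsSymmetry.isRestriction_restrict (hX : S.IsSymmetry X) :
    S.Q.IsRestriction X hX.restrict :=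
  fun _ _ => rfl

theorem isRestriction_unique {Q : VectorField O 1} {x y : VectorField Q.zeroLocus ε}
    (hx : Q.IsRestriction X x) (hy : Q.IsRestriction X y) : x = y := by
  ext U f
  obtain ⟨F, rfl⟩ := toZeroLocus_surjective Q U f
  rw [hx, hy]

theorem IsSymmetry.poissonPreservedBy (hX : S.IsSymmetry X) {x : VectorField S.Q.zeroLocus ε}
    (hx : S.Q.IsRestriction X x) : S.PoissonPreservedBy x := by
  rintro U i _ g ⟨F, hF, rfl⟩
  obtain ⟨G, rfl⟩ := toZeroLocus_surjective S.Q U g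
  change x.app U (S.poisson U (S.Q.toZeroLocus U F) _)
    - S.poisson U (x.app U (S.Q.toZeroLocus U F)) _ - _ • S.poisson U (S.Q.toZeroLocus U F) _ = 0
  rw [hx, hx, S.poisson_toZeroLocus, S.poisson_toZeroLocus, S.poisson_toZeroLocus, hx,
    ← toZeroLocus_sign_smul, ← map_sub, ← map_sub]
  have h1 := hX.preserves U i F (S.Q.app U G) hF
  rw [hX.app_Q, map_sign_smul, smul_smul, ← uzpow_add,
    (by decide : ∀ i ε : ZMod 2, (i + 1) * ε + ε = i * ε)] at h1
  rw [h1, map_zero]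

/-- Near a point of the zero locus a symmetry is the Hamiltonian vector field of a `Q`-closed
function. -/
theorem IsSymmetry.exists_closed_hamiltonian (hO : IsSupermanifold N N O) (hX : S.IsSymmetry X)
    {z : M} (hz : z ∈ S.Q.zeroSet) :
    ∃ (V : Opens M) (H : O.Sec V), z ∈ V ∧ S.Q.app V H = 0 ∧
      ∀ (U : Opens M) (k : U ≤ V) (F : O.Sec U), X.app U F = S.bracket.br U (O.res k H) F := by
  obtain ⟨c, hzc⟩ := hO.exists_chart z
  obtain ⟨V, h, hzV, hV⟩ := c.exists_convex_nhd hzc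
  obtain ⟨H, hH, hXH⟩ := c.exists_hamiltonian h S.nondegenerate hV hX.preserves
  refine ⟨V, H, hzV, ?_, hXH⟩
  have hXV : ∀ F, X.app V F = S.bracket.br V H F := fun F => by
    rw [hXH V le_rfl F, O.res_self]
  -- `[Q, X]` is the Hamiltonian vector field of `Q H`
  have hQH : ∀ F, S.bracket.br V (S.Q.app V H) F = 0 := by
    intro F
    have h1 := S.Q_preserves V (ε + 1) H F hH
    rw [← hXV, ← hXV, hX.app_Q, smul_smul, ← uzpow_add,
      (by decide : ∀ ε : ZMod 2, (ε + 1 + 1) * 1 + ε = 0), uzpow_zero, one_smul, sub_right_comm,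
      sub_self, zero_sub, neg_eq_zero] at h1
    exact h1
  obtain ⟨r, hr⟩ := c.eq_algebraMap_of_br_eq_zero h S.nondegenerate hV
    (F := S.Q.app V H) fun b => by
      rw [S.bracket.antisymm (c.rcoord_mem h b) (S.Q.app_mem hH), hQH, smul_zero, neg_zero]
  -- a nonzero constant would be invertible, but `Q H` vanishes at `z`
  have hr0 : r = 0 := by
    by_contra h0
    refine hz V hzV H ?_
    rw [hr]
    exact (IsUnit.mk0 r h0).map (algebraMap ℝ (O.Sec V))
  rw [hr, hr0, map_zero]

theorem br_algebraMap_left (B : Antibracket O) {U : Opens M} (r : ℝ) (F : O.Sec U) :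
    B.br U (algebraMap ℝ _ r) F = 0 := by
  have hom : ∀ i, ∀ F ∈ O.part U i, B.br U (algebraMap ℝ _ r) F = 0 := by
    intro i F hF
    have h1 : algebraMap ℝ (O.Sec U) r ∈ O.part U 0 := by
      rw [Algebra.algebraMap_eq_smul_one]
      exact Submodule.smul_mem _ _ (O.one_mem U)
    rw [B.antisymm h1 hF, (B.isGradedDerivation O hF).map_algebraMap, smul_zero, neg_zero]
  obtain ⟨F₀, h₀, F₁, h₁, rfl⟩ := O.exists_parts F
  rw [map_add, hom 0 F₀ h₀, hom 1 F₁ h₁, add_zero]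

/-- On the zero locus, the Hamiltonian vector field of `Q G` for the antibracket is up to sign that
of `G` for the Poisson bracket. -/
theorem toZeroLocus_br_Q {U : Opens M} {i : ZMod 2} {G : O.Sec U} (hG : G ∈ O.part U i)
    (F : O.Sec U) :
    S.Q.toZeroLocus U (S.bracket.br U (S.Q.app U G) F) =
      S.poisson U (S.Q.toZeroLocus U (((-1 : ℤˣ) ^ i) • G)) (S.Q.toZeroLocus U F) := by
  have h1 := S.Q_preserves U i G F hG
  rw [sub_right_comm, sub_eq_zero, mul_one, uzpow_add, uzpow_one, mul_neg_one, Units.neg_smul,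
    sub_neg_eq_add] at h1
  have h2 : S.bracket.br U (((-1 : ℤˣ) ^ i) • G) (S.Q.app U F) =
      ((-1 : ℤˣ) ^ i) • S.bracket.br U G (S.Q.app U F) :=
    map_sign_smul ((S.bracket.br U).flip (S.Q.app U F)) _ G
  rw [S.poisson_toZeroLocus, h2, ← h1, map_add]
  have h3 : S.Q.toZeroLocus U (S.Q.app U (S.bracket.br U G F)) = 0 :=
    Ideal.Quotient.eq_zero_iff_mem.2 (S.Q.app_mem_zeroIdeal _)
  rw [h3, zero_add]

theorem IsSymmetry.isLocallyHamiltonian (hO : IsSupermanifold N N O) (hS : S.IsPQP)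
    (hX : S.IsSymmetry X) {x : VectorField S.Q.zeroLocus ε} (hx : S.Q.IsRestriction X x) :
    S.IsLocallyHamiltonian x := by
  intro z hz
  obtain ⟨V, H, hzV, hQH, hXH⟩ := hX.exists_closed_hamiltonian hO hz
  obtain ⟨U, k, hzU, r, G, hG⟩ := hS.cohomology z hz V hzV H hQH
  obtain ⟨G₀, h₀, G₁, h₁, rfl⟩ := O.exists_parts G
  -- `{G₀ - G₁, ·}` is the restriction of `(Q G₀ + Q G₁, ·)`
  refine ⟨U, hzU, S.Q.toZeroLocus U (G₀ - G₁), fun W l g => ?_⟩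
  obtain ⟨F, rfl⟩ := toZeroLocus_surjective S.Q W g
  have e0 := toZeroLocus_br_Q (S := S) (O.res_mem l h₀) F
  have e1 := toZeroLocus_br_Q (S := S) (O.res_mem l h₁) F
  have e2 : S.Q.zeroLocus.res l (S.Q.toZeroLocus U (G₀ - G₁)) =
      S.Q.toZeroLocus W (O.res l G₀ - O.res l G₁) := congrArg (S.Q.toZeroLocus W) (map_sub _ _ _)
  rw [uzpow_zero, one_smul, S.poisson_toZeroLocus] at e0
  rw [uzpow_one, Units.neg_smul, one_smul, S.poisson_toZeroLocus] at e1
  rw [e2, hx, hXH W (l.trans k), ← O.res_res l k, hG, map_add, AlgHom.commutes, map_add,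
    LinearMap.add_apply, br_algebraMap_left, zero_add, map_add, map_add, ← S.Q.app_res,
    ← S.Q.app_res, map_add, LinearMap.add_apply, map_add, e0, e1, S.poisson_toZeroLocus, ← map_add,
    ← LinearMap.add_apply, ← map_add, sub_eq_add_neg]

end QPStructure

end Super

theorem mainTheorem4 {N : ℕ} {M : Type u} [TopologicalSpace M] [T2Space M]
    [SecondCountableTopology M] [ChartedSpace (EuclideanSpace ℝ (Fin N)) M]
    [IsManifold 𝓘(ℝ, EuclideanSpace ℝ (Fin N)) ∞ M]
    (O : Super.SuperPresheaf.{u, v} M) (hO : Super.IsSupermanifold N N O)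
    (S : Super.QPStructure N O) (hS : S.IsPQP)
    {ε : ZMod 2} (X : Super.VectorField O ε) (hX : S.IsSymmetry X) :
    (∃! x : Super.VectorField S.Q.zeroLocus ε, S.Q.IsRestriction X x) ∧
    ∀ x : Super.VectorField S.Q.zeroLocus ε, S.Q.IsRestriction X x →
      S.PoissonPreservedBy x ∧ S.IsLocallyHamiltonian x :=
  ⟨⟨hX.restrict, hX.isRestriction_restrict,
    fun _ hy => Super.QPStructure.isRestriction_unique hy hX.isRestriction_restrict⟩,
    fun _ hx => ⟨hX.poissonPreservedBy hx, hX.isLocallyHamiltonian hO hS hx⟩⟩
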